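/- Fix $n\ge 1$. Let $T$ be the graph with nodes $(i,j)$, $0\le i\le n-1$, $1\le j\le n-i$, in which for $i\ge 1$ the node $(i,j)$ is adjacent to $(i-1,j)$ and to $(i-1,j+1)$. A subgraph $\Delta\subset T$ is called ordinary if it is connected, induced, and whenever it contains both $(i,j)$ and $(i,j+1)$ it also contains $(i-1,j+1)$ and $(i+1,j)$ (in particular it never contains two neighbouring nodes $(0,j),(0,j+1)$ of row $0$). Such a $\Delta$ has exactly one node $(i_\Delta,j_\Delta)$ in its top (smallest-$i$) row. Let $C_\Delta\subset\mathbb{R}^{\binom{n+1}{2}}$ be the cone of all points $x=(x_{i,j})$ such that $x_{i,j}=0$ for $(i,j)\notin\Delta$, $x_{i_\Delta,j_\Delta}=0$, and for every edge of $\Delta$ the corresponding inequality holds: $x_{i,j}\ge x_{i+1,j}$ for an edge joining $(i,j)$ and $(i+1,j)$, and $x_{i+1,j}\ge x_{i,j+1}$ for an edge joining $(i+1,j)$ and $(i,j+1)$. For a set $P\subset\mathbb{R}^m$ let $S(P)=\sum_{a\in P\cap\mathbb{Z}^m}\mathbf{t}^a$ be its formal generating function. If $q\,S(P)$ is a Laurent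 polynomial for some nonzero Laurent polynomial $q$ with integer coefficients, the integer-point transform of $P$ is the rational function $\sigma(P)=qS(P)/q$, which does not depend on $q$. For a rational function $Q$ in the variables $t_{i,j}$ let $F(Q)$ be the rational function in $x_1,\dots,x_n$ obtained by substituting $t_{0,j}\mapsto x_1$ and $t_{i,j}\mapsto x_i^{-1}x_{i+1}$ for $i>0$; it is defined when $Q$ can be written as a quotient of Laurent polynomials whose denominator does not become zero under the substitution. Theorem. If an ordinary subgraph $\Delta$ of $T$ contains a cycle, then $\sigma(C_\Delta)$ and $F(\sigma(C_\Delta))$ are defined, and $F(\sigma(C_\Delta))=0$. -/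

import Mathlib

noncomputable section

namespace GTCone

/-! ### Laurent polynomials, rational functions, generating functions -/

/-- Laurent polynomials with integer coefficients in variables indexed by `ι`;
the monomial `t ^ a` is indexed by its exponent vector `a : ι → ℤ`. -/
abbrev LaurentPoly (ι : Type) : Type := AddMonoidAlgebra ℤ (ι → ℤ)

/-- The field of rational functions in variables indexed by `ι`. -/
abbrev RatFun (ι : Type) : Type := FractionRing (LaurentPoly ι)

/-- Formal (bi-infinite) Laurent series: arbitrary families of coefficients. -/
abbrev LaurentSeries (ι : Type) : Type := (ι → ℤ) → ℤ

open Classical in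
/-- The generating function `S(P) = ∑ t ^ a` over the integer points `a` of `P`. -/
def genFun {ι : Type} (P : Set (ι → ℝ)) : LaurentSeries ι :=
  fun a => if (fun i => (a i : ℝ)) ∈ P then 1 else 0

/-- The product of a Laurent polynomial and a formal Laurent series. -/
def mulSeries {ι : Type} (q : LaurentPoly ι) (s : LaurentSeries ι) : LaurentSeries ι :=
  fun a => q.coeff.sum fun b c => c * s (a - b)

/-- `q ≠ 0` and the product `q * S(P)` is finite, equal to the Laurent polynomial `p`. -/
def IsTransformPair {ι : Type} (P : Set (ι → ℝ)) (p q : LaurentPoly ι) : Prop :=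
  q ≠ 0 ∧ mulSeries q (genFun P) = fun a => p.coeff a

/-- Some nonzero Laurent polynomial multiple of `S(P)` is a Laurent polynomial, so that the
integer-point transform of `P` is defined. -/
def HasTransform {ι : Type} (P : Set (ι → ℝ)) : Prop :=
  ∃ p q : LaurentPoly ι, IsTransformPair P p q

open Classical in
/-- The integer-point transform `σ(P) = (q * S(P)) / q`, a rational function (independent of `q`,
see `sigma_eq`); by convention `0` if `HasTransform P` fails. -/
def sigma {ι : Type} (P : Set (ι → ℝ)) : RatFun ι :=
  if h : HasTransform P then
    algebraMap (LaurentPoly ι) (RatFun ι) h.choose /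
      algebraMap (LaurentPoly ι) (RatFun ι) h.choose_spec.choose
  else 0

theorem mulSeries_add {ι : Type} (p q : LaurentPoly ι) (s : LaurentSeries ι) :
    mulSeries (p + q) s = mulSeries p s + mulSeries q s := by
  funext a
  simp only [mulSeries, Pi.add_apply, AddMonoidAlgebra.coeff_add]
  exact Finsupp.sum_add_index' (by simp) (by intros; ring)

theorem mulSeries_single {ι : Type} (b : ι → ℤ) (c : ℤ) (s : LaurentSeries ι) (a : ι → ℤ) :
    mulSeries (AddMonoidAlgebra.single b c) s a = c * s (a - b) := by
  simp [mulSeries]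

theorem mulSeries_add_right {ι : Type} (q : LaurentPoly ι) (s u : LaurentSeries ι) :
    mulSeries q (s + u) = mulSeries q s + mulSeries q u := by
  funext a
  simp [mulSeries, mul_add, Finsupp.sum_add]

theorem mulSeries_mul {ι : Type} (p q : LaurentPoly ι) (s : LaurentSeries ι) :
    mulSeries (p * q) s = mulSeries p (mulSeries q s) := by
  induction p using AddMonoidAlgebra.induction_linear with
  | zero => funext a; simp [mulSeries]
  | add f g hf hg => rw [add_mul, mulSeries_add, hf, hg, mulSeries_add]
  | single b c =>
    induction q using AddMonoidAlgebra.induction_linear with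
    | zero => funext a; simp [mulSeries]
    | add f g hf hg => rw [mul_add, mulSeries_add, hf, hg, mulSeries_add, mulSeries_add_right]
    | single b' c' =>
      funext a
      rw [AddMonoidAlgebra.single_mul_single, mulSeries_single, mulSeries_single,
        mulSeries_single, sub_add_eq_sub_sub, mul_assoc]

theorem mulSeries_coeff {ι : Type} (p q : LaurentPoly ι) :
    mulSeries p (fun a => q.coeff a) = fun a => (p * q).coeff a := by
  induction p using AddMonoidAlgebra.induction_linear with
  | zero => funext a; simp [mulSeries]
  | add f g hf hg => rw [mulSeries_add, hf, hg, add_mul]; funext a; simp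
  | single b c =>
    funext a
    rw [mulSeries_single]
    have h := AddMonoidAlgebra.coeff_single_mul_add q c b (a - b)
    rwa [add_sub_cancel, eq_comm] at h

/-- The integer-point transform does not depend on the choice of the multiplier. -/
theorem sigma_eq {ι : Type} {P : Set (ι → ℝ)} {p q : LaurentPoly ι} (h : IsTransformPair P p q) :
    sigma P = algebraMap (LaurentPoly ι) (RatFun ι) p / algebraMap (LaurentPoly ι) (RatFun ι) q := by
  have h' : HasTransform P := ⟨p, q, h⟩
  have key : ∀ {p q p' q' : LaurentPoly ι}, IsTransformPair P p q → IsTransformPair P p' q' →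
      q' * p = q * p' := by
    intro p q p' q' h h'
    apply AddMonoidAlgebra.coeff_injective
    apply DFunLike.coe_injective
    refine (mulSeries_coeff q' p).symm.trans (Eq.trans ?_ (mulSeries_coeff q p'))
    rw [← h.2, ← h'.2, ← mulSeries_mul, ← mulSeries_mul, mul_comm]
  have inj := IsFractionRing.injective (LaurentPoly ι) (RatFun ι)
  have hs := h'.choose_spec.choose_spec
  rw [sigma, dif_pos h', div_eq_div_iff ((map_ne_zero_iff _ inj).2 hs.1)
    ((map_ne_zero_iff _ inj).2 h.1), ← map_mul, ← map_mul, mul_comm, key hs h, mul_comm]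

/-! ### The specialization -/

/-- The positions `(i, j)`, `0 ≤ i ≤ n - 1`, `1 ≤ j ≤ n - i`, of a triangular array with `n`
rows. -/
abbrev Node (n : ℕ) : Type :=
  {u : ℕ × ℕ // u ∈ (Finset.range n ×ˢ Finset.Icc 1 n).filter fun u => u.1 + u.2 ≤ n}

/-- The row index `i` of the node `(i, j)`. -/
abbrev Node.row {n : ℕ} (u : Node n) : ℕ := u.1.1

/-- The index `j` of the node `(i, j)` within its row. -/
abbrev Node.col {n : ℕ} (u : Node n) : ℕ := u.1.2

/-- The exponent vector of the monomial substituted for the variable `t_{i,j}`: it is that of `x_1`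
if `i = 0` and of `x_i⁻¹ x_{i+1}` if `i > 0`. The variable `x_k`, `1 ≤ k ≤ n`, has
index `k - 1` in `Fin n`. -/
def nodeWeight {n : ℕ} (u : Node n) : Fin n → ℤ :=
  fun k => if (k : ℕ) = u.row then 1 else if (k : ℕ) + 1 = u.row then -1 else 0

/-- The map on exponent vectors induced by the substitution. -/
def weightHom (n : ℕ) : (Node n → ℤ) →+ (Fin n → ℤ) where
  toFun a := ∑ u : Node n, a u • nodeWeight u
  map_zero' := by simp
  map_add' a b := by simp [add_smul, Finset.sum_add_distrib]

/-- The substitution `t_{i,j} ↦ x_1` for `i = 0`, `t_{i,j} ↦ x_i⁻¹ x_{i+1}` for `i > 0`, on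
Laurent polynomials. -/
def specPoly (n : ℕ) : LaurentPoly (Node n) →+* LaurentPoly (Fin n) :=
  AddMonoidAlgebra.mapDomainRingHom ℤ (weightHom n)

/-- `p / q` is a representation of the rational function `Q` whose denominator does not vanish
under the substitution. -/
def IsSpecPair {n : ℕ} (Q : RatFun (Node n)) (p q : LaurentPoly (Node n)) : Prop :=
  specPoly n q ≠ 0 ∧
    Q = algebraMap (LaurentPoly (Node n)) (RatFun (Node n)) p /
      algebraMap (LaurentPoly (Node n)) (RatFun (Node n)) q

/-- The substitution may be applied to `Q`. -/
def Specializable {n : ℕ} (Q : RatFun (Node n)) : Prop :=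
  ∃ p q : LaurentPoly (Node n), IsSpecPair Q p q

open Classical in
/-- The specialization `F(Q)` of a rational function `Q` (independent of the representation,
see `F_eq`); by convention `0` if `Q` is not `Specializable`. -/
def F {n : ℕ} (Q : RatFun (Node n)) : RatFun (Fin n) :=
  if h : Specializable Q then
    algebraMap (LaurentPoly (Fin n)) (RatFun (Fin n)) (specPoly n h.choose) /
      algebraMap (LaurentPoly (Fin n)) (RatFun (Fin n)) (specPoly n h.choose_spec.choose)
  else 0

/-- The specialization does not depend on the representation as a fraction. -/
theorem F_eq {n : ℕ} {Q : RatFun (Node n)} {p q : LaurentPoly (Node n)} (h : IsSpecPair Q p q) :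
    F Q = algebraMap (LaurentPoly (Fin n)) (RatFun (Fin n)) (specPoly n p) /
      algebraMap (LaurentPoly (Fin n)) (RatFun (Fin n)) (specPoly n q) := by
  have h' : Specializable Q := ⟨p, q, h⟩
  have hs := h'.choose_spec.choose_spec
  have inj := IsFractionRing.injective (LaurentPoly (Node n)) (RatFun (Node n))
  have inj' := IsFractionRing.injective (LaurentPoly (Fin n)) (RatFun (Fin n))
  have ne : ∀ {q : LaurentPoly (Node n)}, specPoly n q ≠ 0 → q ≠ 0 := by
    rintro q hq rfl
    exact hq (map_zero _)
  have e := hs.2.symm.trans h.2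
  rw [div_eq_div_iff ((map_ne_zero_iff _ inj).2 (ne hs.1)) ((map_ne_zero_iff _ inj).2 (ne h.1)),
    ← map_mul, ← map_mul] at e
  rw [F, dif_pos h', div_eq_div_iff ((map_ne_zero_iff _ inj').2 hs.1)
    ((map_ne_zero_iff _ inj').2 h.1), ← map_mul, ← map_mul, ← map_mul, ← map_mul, inj e]

/-! ### The triangle graph, ordinary subgraphs and their cones -/

/-- `u` is the upper-left neighbor of `w`: `w = (i, j)` and `u = (i - 1, j)`. -/
def UpperLeft {n : ℕ} (u w : Node n) : Prop := w.row = u.row + 1 ∧ u.col = w.col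

/-- `u` is the upper-right neighbor of `w`: `w = (i, j)` and `u = (i - 1, j + 1)`. -/
def UpperRight {n : ℕ} (u w : Node n) : Prop := w.row = u.row + 1 ∧ u.col = w.col + 1

/-- The graph `T`: for `i ≥ 1` the node `(i, j)` is adjacent to `(i - 1, j)` and
`(i - 1, j + 1)`. -/
def triangleGraph (n : ℕ) : SimpleGraph (Node n) :=
  SimpleGraph.fromRel fun u w => UpperLeft u w ∨ UpperRight u w

/-- Property A: if `u = (i, j)` and `w = (i, j + 1)` are nodes of `Δ`, then so are `(i - 1, j + 1)`
and `(i + 1, j)`. In particular two adjacent nodes of row `0` are never both in `Δ`. -/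
def PropertyA {n : ℕ} (Δ : (triangleGraph n).Subgraph) : Prop :=
  ∀ u ∈ Δ.verts, ∀ w ∈ Δ.verts, w.row = u.row → w.col = u.col + 1 →
    (∃ a ∈ Δ.verts, a.row + 1 = u.row ∧ a.col = u.col + 1) ∧
    (∃ b ∈ Δ.verts, b.row = u.row + 1 ∧ b.col = u.col)

/-- Ordinary subgraphs: connected, induced, with property A. -/
structure IsOrdinary {n : ℕ} (Δ : (triangleGraph n).Subgraph) : Prop where
  connected : Δ.Connected
  induced : Δ.IsInduced
  propertyA : PropertyA Δ

/-- `u` is a node of `Δ` in the top row that meets `Δ` (for ordinary `Δ` there is exactly one). -/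
def IsTopNode {n : ℕ} (Δ : (triangleGraph n).Subgraph) (u : Node n) : Prop :=
  u ∈ Δ.verts ∧ ∀ w ∈ Δ.verts, u.row ≤ w.row

/-- The cone `C_Δ`: coordinates outside `Δ` and the coordinate of the top node vanish, and for every
edge of `Δ` the endpoints satisfy the corresponding Gelfand-Tsetlin inequality
`x_{i,j} ≥ x_{i+1,j}` or `x_{i+1,j} ≥ x_{i,j+1}`. -/
def cone {n : ℕ} (Δ : (triangleGraph n).Subgraph) : Set (Node n → ℝ) :=
  {x | (∀ u, u ∉ Δ.verts → x u = 0) ∧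
    (∀ u, IsTopNode Δ u → x u = 0) ∧
    ∀ u w, Δ.Adj u w → (UpperLeft u w → x w ≤ x u) ∧ (UpperRight u w → x u ≤ x w)}

end GTCone

end

/-!
The substitution `F` sends the variables of row `0` to `x_1` and those of row `i > 0` to
`x_i⁻¹ x_{i+1}`; these monomials are algebraically independent, so `F` amounts to remembering only
the row sums of a point (`weightHom_eq`). The theorem states that the sum of `z ^ (row sums)` over
the integer points of the cone, regularized as a rational function, is zero.

Regularization. A function `f` on a lattice, with values in a field, has a regularized sum if
`q * f` is finitely supported for some `q` in the group algebra with nonzero sum of coefficients.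
This sum is additive, invariant under summation along the fibers of a homomorphism when these meet
the support in finite sets, and hence also under bijections that preserve such fibers, linear or not
(`RegZero.of_fiberwise_equiv`). The functions used are indicator functions of sets of lattice points
times characters. If such a set is stable under translation by `v`, it may be replaced by its points
that are not in the translate (`RegZero.of_peel`); if it is invariant under `v`, and `v` has
nontrivial weight, the regularized sum is zero. All order cones have regularized sums: inclusion and
exclusion reduces them to chains, whose denominators are products of `1 - t ^ (± ind J)`, where
`ind J` is the indicator vector of a nonempty set `J` (`isRational_orderCone`), and row sums do not
vanish on these vectors. This also shows that the transform and its specialization are defined.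

Reflection of a row. An ordinary subgraph has an interval of columns in each row, the ends of the
interval move by half a step from row to row, and the first and the last row have one node
(`exists_isShape`). A cycle forces some row to have several nodes. Let `i` be the first row of
maximal width. For fixed neighboring rows each entry of row `i` varies independently between the
maximum of its right neighbors and the minimum of its left neighbors; an end node of the row may lack
neighbors on its outer side. Entries without an outer bound are first peeled to their only bound.
Then every remaining entry is reflected in its interval. For adjacent nodes of the row, the lower
bound of the left one and the upper bound of the right one are the maximum and the minimum of the
same two entries, so the interval ends add up to the sum of both neighboring rows
(`IsWideRow.sum_lo_add_up`), and the reflection acts on row sums linearly. Thus the problem for `D`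
reduces to that for `D` without the unbounded end nodes of row `i`, with reflected row weights
(`IsWideRow.regZero_of_trim`).

The smaller set is again of the same type, unless row `i` had exactly two nodes and lost both. In this
case the nodes below row `i` are disconnected from the top node, whose entry is fixed to be zero, and
can be translated together; hence the regularized sum is zero (`IsShape.regZero`).
-/

namespace GTCone

/-! ### Regularized sums of functions on abelian groups -/

section Regularization

set_option linter.unusedSectionVars false

open AddMonoidAlgebra

variable {k G H : Type*} [CommRing k] [IsDomain k] [AddCommGroup G] [AddCommGroup H]

/-- The convolution product of an element of the group algebra and an arbitrary function on the
group. Over `ℤ` and for `G = ι → ℤ` this is `mulSeries`. -/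
noncomputable def conv (q : AddMonoidAlgebra k G) (f : G → k) : G → k :=
  fun a => q.coeff.sum fun b c => c * f (a - b)

theorem conv_zero_left (f : G → k) : conv 0 f = 0 := by
  funext a
  simp [conv]

theorem conv_add_left (p q : AddMonoidAlgebra k G) (f : G → k) :
    conv (p + q) f = conv p f + conv q f := by
  funext a
  simp only [conv, Pi.add_apply, coeff_add]
  exact Finsupp.sum_add_index' (by simp) (by intros; ring)

theorem conv_single (b : G) (c : k) (f : G → k) (a : G) :
    conv (single b c) f a = c * f (a - b) := by
  simp [conv]

theorem conv_one (f : G → k) : conv 1 f = f := by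
  funext a
  rw [one_def, conv_single]
  simp

theorem conv_add_right (q : AddMonoidAlgebra k G) (f g : G → k) :
    conv q (f + g) = conv q f + conv q g := by
  funext a
  simp [conv, mul_add, Finsupp.sum_add]

theorem conv_zero_right (q : AddMonoidAlgebra k G) : conv q (0 : G → k) = 0 := by
  funext a
  simp [conv]

theorem conv_neg_right (q : AddMonoidAlgebra k G) (f : G → k) : conv q (-f) = -conv q f := by
  rw [eq_neg_iff_add_eq_zero, ← conv_add_right, neg_add_cancel, conv_zero_right]

theorem conv_mul (p q : AddMonoidAlgebra k G) (f : G → k) :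
    conv (p * q) f = conv p (conv q f) := by
  induction p using AddMonoidAlgebra.induction_linear with
  | zero => rw [zero_mul, conv_zero_left, conv_zero_left]
  | add p₁ p₂ h₁ h₂ => rw [add_mul, conv_add_left, h₁, h₂, conv_add_left]
  | single b c =>
    induction q using AddMonoidAlgebra.induction_linear with
    | zero => rw [mul_zero, conv_zero_left, conv_zero_right]
    | add q₁ q₂ h₁ h₂ => rw [mul_add, conv_add_left, h₁, h₂, conv_add_left, conv_add_right]
    | single b' c' =>
      funext a
      rw [single_mul_single, conv_single, conv_single, conv_single, sub_add_eq_sub_sub, mul_assoc]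

theorem conv_coeff (p q : AddMonoidAlgebra k G) :
    conv p (fun a => q.coeff a) = fun a => (p * q).coeff a := by
  induction p using AddMonoidAlgebra.induction_linear with
  | zero => rw [conv_zero_left, zero_mul]; rfl
  | add f g hf hg => rw [conv_add_left, hf, hg, add_mul]; funext a; simp
  | single b c =>
    funext a
    rw [conv_single]
    have h := coeff_single_mul_add q c b (a - b)
    rwa [add_sub_cancel, eq_comm] at h

theorem coeff_ext {p q : AddMonoidAlgebra k G} (h : (fun a => p.coeff a) = fun a => q.coeff a) :
    p = q :=
  coeff_injective (DFunLike.coe_injective h)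

/-- The sum of the coefficients. -/
noncomputable def aug : AddMonoidAlgebra k G →+* k :=
  liftNCRingHom (RingHom.id k) 1 fun _ _ => Commute.all _ _

theorem aug_single (a : G) (c : k) : aug (single a c) = c := by
  simp [aug]

/-- A function that becomes finitely supported after convolution with a multiplier of nonzero
augmentation. -/
def Reg (f : G → k) : Prop :=
  ∃ q p : AddMonoidAlgebra k G, aug q ≠ 0 ∧ conv q f = fun a => p.coeff a

/-- A regularizable function whose regularized sum `aug (q * f) / aug q` is zero. -/
def RegZero (f : G → k) : Prop :=
  ∃ q p : AddMonoidAlgebra k G, aug q ≠ 0 ∧ (conv q f = fun a => p.coeff a) ∧ aug p = 0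

/-- The vanishing of the regularized sum is seen by every multiplier. -/
theorem RegZero.aug_eq_zero {f : G → k} (hf : RegZero f) {q p : AddMonoidAlgebra k G}
    (h : conv q f = fun a => p.coeff a) : aug p = 0 := by
  obtain ⟨q', p', hq', h', hp'⟩ := hf
  have e : q' * p = q * p' := by
    apply coeff_ext
    rw [← conv_coeff, ← conv_coeff, ← h, ← h', ← conv_mul, ← conv_mul, mul_comm]
  have e' := congrArg aug e
  rw [map_mul, map_mul, hp', mul_zero] at e'
  exact (mul_eq_zero.1 e').resolve_left hq'

theorem Reg.conv {f : G → k} (hf : Reg f) (h : AddMonoidAlgebra k G) : Reg (conv h f) := by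
  obtain ⟨q, p, hq, e⟩ := hf
  refine ⟨q, h * p, hq, ?_⟩
  rw [← conv_mul, mul_comm, conv_mul, e, conv_coeff]

theorem RegZero.of_conv {f : G → k} {h : AddMonoidAlgebra k G} (hh : aug h ≠ 0)
    (hf : RegZero (conv h f)) : RegZero f := by
  obtain ⟨q, p, hq, e, hp⟩ := hf
  refine ⟨q * h, p, ?_, ?_, hp⟩
  · rw [map_mul]
    exact mul_ne_zero hq hh
  · rw [conv_mul, e]

theorem regZero_zero : RegZero (0 : G → k) := by
  refine ⟨1, 0, ?_, ?_, map_zero _⟩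
  · rw [map_one]
    exact one_ne_zero
  · rw [conv_one]
    rfl

/-! ### Summation along the fibers of a homomorphism -/

/-- The fibers of `π` meet the support of `f` in finite sets. -/
def FiberFinite (π : G →+ H) (f : G → k) : Prop :=
  ∀ h, ((π ⁻¹' {h}).indicator f).support.Finite

/-- The function on `H` obtained by summing `f` over the fibers of `π : G →+ H`. -/
noncomputable def push (π : G →+ H) (f : G → k) : H → k :=
  fun h => ∑ᶠ x, (π ⁻¹' {h}).indicator f x

theorem FiberFinite.add {π : G →+ H} {f g : G → k} (hf : FiberFinite π f) (hg : FiberFinite π g) :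
    FiberFinite π (f + g) := by
  intro h
  rw [Set.indicator_add']
  exact ((hf h).union (hg h)).subset (Function.support_add _ _)

theorem push_add {π : G →+ H} {f g : G → k} (hf : FiberFinite π f) (hg : FiberFinite π g) :
    push π (f + g) = push π f + push π g := by
  funext h
  simp only [push, Pi.add_apply, Set.indicator_add']
  exact finsum_add_distrib (hf h) (hg h)

theorem push_zero (π : G →+ H) : push π (0 : G → k) = 0 := by
  funext h
  simp [push]

theorem indicator_fiber_conv_single (π : G →+ H) (b : G) (c : k) (f : G → k) (h : H) :
    (π ⁻¹' {h}).indicator (conv (single b c) f) =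
      fun x => c * (π ⁻¹' {h - π b}).indicator f (Equiv.subRight b x) := by
  funext x
  by_cases hx : π x = h
  · simp [Set.indicator, hx, conv_single]
  · simp [Set.indicator, hx, sub_left_inj]

theorem FiberFinite.conv {π : G →+ H} {f : G → k} (hf : FiberFinite π f)
    (q : AddMonoidAlgebra k G) : FiberFinite π (conv q f) := by
  induction q using AddMonoidAlgebra.induction_linear with
  | zero => intro h; simp [conv_zero_left]
  | add p q hp hq => rw [conv_add_left]; exact hp.add hq
  | single b c =>
    intro h
    rw [indicator_fiber_conv_single]
    refine ((hf (h - π b)).preimage (Equiv.subRight b).injective.injOn).subset ?_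
    intro x hx
    exact right_ne_zero_of_mul hx

theorem fiberFinite_coeff (π : G →+ H) (p : AddMonoidAlgebra k G) :
    FiberFinite π fun a => p.coeff a := by
  intro h
  refine p.coeff.hasFiniteSupport.subset ?_
  rw [Set.support_indicator]
  exact Set.inter_subset_right

/-- Summation along fibers is linear over the homomorphism of group algebras. -/
theorem conv_push {π : G →+ H} {f : G → k} (hf : FiberFinite π f) (q : AddMonoidAlgebra k G) :
    conv (mapDomain π q) (push π f) = push π (conv q f) := by
  induction q using AddMonoidAlgebra.induction_linear with
  | zero => rw [mapDomain_zero, conv_zero_left, conv_zero_left, push_zero]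
  | add p q hp hq =>
    rw [mapDomain_add, conv_add_left, hp, hq, conv_add_left, push_add (hf.conv p) (hf.conv q)]
  | single b c =>
    funext h
    rw [mapDomain_single, conv_single]
    simp only [push, indicator_fiber_conv_single]
    rw [finsum_comp_equiv (Equiv.subRight b)
      (f := fun y => c * (π ⁻¹' {h - π b}).indicator f y), mul_finsum]

theorem push_coeff (π : G →+ H) (p : AddMonoidAlgebra k G) :
    (push π fun a => p.coeff a) = fun a => (mapDomain π p).coeff a := by
  induction p using AddMonoidAlgebra.induction_linear with
  | zero => rw [mapDomain_zero]; exact push_zero π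
  | add p q hp hq =>
    rw [mapDomain_add]
    have := push_add (fiberFinite_coeff π p) (fiberFinite_coeff π q)
    rw [hp, hq] at this
    refine Eq.trans ?_ (this.trans ?_)
    · congr 1
    · funext a; simp
  | single b c =>
    classical
    funext h
    rw [mapDomain_single]
    simp only [push]
    rw [finsum_eq_single _ b]
    · by_cases hb : π b = h <;> simp [Set.indicator, hb]
    · intro x hx
      simp [Set.indicator, hx.symm]

theorem aug_mapDomain (π : G →+ H) (p : AddMonoidAlgebra k G) : aug (mapDomain π p) = aug p := by
  induction p using AddMonoidAlgebra.induction_linear with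
  | zero => rw [mapDomain_zero, map_zero, map_zero]
  | add p q hp hq => rw [mapDomain_add, map_add, map_add, hp, hq]
  | single b c => rw [mapDomain_single, aug_single, aug_single]

theorem RegZero.push {π : G →+ H} {f : G → k} (hπ : FiberFinite π f) (hf : RegZero f) :
    RegZero (push π f) := by
  obtain ⟨q, p, hq, e, hp⟩ := hf
  refine ⟨mapDomain π q, mapDomain π p, ?_, ?_, ?_⟩
  · rwa [aug_mapDomain]
  · rw [conv_push hπ, e, push_coeff]
  · rwa [aug_mapDomain]

theorem RegZero.of_push {π : G →+ H} {f : G → k} (hπ : FiberFinite π f)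
    (hf : Reg f) (h : RegZero (GTCone.push π f)) : RegZero f := by
  obtain ⟨q, p, hq, e⟩ := hf
  refine ⟨q, p, hq, e, ?_⟩
  rw [← aug_mapDomain π]
  refine h.aug_eq_zero (q := mapDomain π q) ?_
  rw [conv_push hπ, e, push_coeff]

/-- A bijection `T` that preserves the fibers of `π` transports the vanishing of the regularized
sum, although it need not be a homomorphism. -/
theorem RegZero.of_fiberwise_equiv {π : G →+ H} {f g : G → k} (T : G ≃ G)
    (hT : ∀ x, π (T x) = π x) (hfg : ∀ x, f (T x) = g x) (hg : FiberFinite π g) (hf : Reg f)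
    (h : RegZero g) : RegZero f := by
  have key : ∀ y, (π ⁻¹' {y}).indicator g = (π ⁻¹' {y}).indicator f ∘ T := by
    intro y
    funext x
    by_cases hx : π x = y
    · rw [Function.comp_apply, Set.indicator_of_mem (by exact hx),
        Set.indicator_of_mem (by exact (hT x).trans hx), hfg]
    · rw [Function.comp_apply, Set.indicator_of_notMem (by exact hx),
        Set.indicator_of_notMem (by exact fun e => hx ((hT x).symm.trans e))]
  have hff : FiberFinite π f := by
    intro y
    have := hg y
    rw [key, Function.support_comp_eq_preimage] at this
    rw [← Set.image_preimage_eq ((π ⁻¹' {y}).indicator f).support T.surjective]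
    exact this.image T
  refine RegZero.of_push hff hf ?_
  have e : GTCone.push π f = GTCone.push π g := by
    funext y
    simp only [GTCone.push, key]
    exact (finsum_comp_equiv T).symm
  rw [e]
  exact h.push hg

/-! ### Weighted indicator functions -/

open Classical in
/-- The indicator function of `P`, multiplied by the character `χ`. -/
noncomputable def wInd (χ : Multiplicative G →* k) (P : Set G) : G → k :=
  fun x => if x ∈ P then χ (.ofAdd x) else 0

theorem wInd_of_mem (χ : Multiplicative G →* k) {P : Set G} {x : G} (h : x ∈ P) :
    wInd χ P x = χ (.ofAdd x) :=
  if_pos h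

theorem wInd_of_notMem (χ : Multiplicative G →* k) {P : Set G} {x : G} (h : x ∉ P) :
    wInd χ P x = 0 :=
  if_neg h

/-- If `P` is stable under translation by `v`, then multiplication by `1 - t ^ v` cuts `P` down to
its points not in `P + v`. -/
theorem conv_wInd (χ : Multiplicative G →* k) {P : Set G} {v : G} (hP : ∀ x, x - v ∈ P → x ∈ P) :
    conv (1 - single v (χ (.ofAdd v))) (wInd χ P) = wInd χ {x | x ∈ P ∧ x - v ∉ P} := by
  have e : (1 - single v (χ (.ofAdd v)) : AddMonoidAlgebra k G) =
      1 + single v (-χ (.ofAdd v)) := by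
    rw [single_neg, sub_eq_add_neg]
  funext x
  rw [e, conv_add_left, Pi.add_apply, conv_one, conv_single]
  have hm : χ (.ofAdd v) * χ (.ofAdd (x - v)) = χ (.ofAdd x) := by
    rw [← map_mul, ← ofAdd_add, add_sub_cancel]
  by_cases h1 : x - v ∈ P
  · rw [wInd_of_mem _ (hP x h1), wInd_of_mem _ h1, wInd_of_notMem _ (fun h => h.2 h1), neg_mul, hm,
      add_neg_cancel]
  · rw [wInd_of_notMem _ h1, mul_zero, add_zero]
    by_cases h2 : x ∈ P
    · rw [wInd_of_mem _ h2, wInd_of_mem (P := {x | x ∈ P ∧ x - v ∉ P}) _ ⟨h2, h1⟩]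
    · rw [wInd_of_notMem _ h2, wInd_of_notMem _ (fun h => h2 h.1)]

theorem aug_one_sub_single (v : G) (c : k) :
    aug (1 - single v c : AddMonoidAlgebra k G) = 1 - c := by
  rw [map_sub, map_one, aug_single]

theorem RegZero.of_peel {χ : Multiplicative G →* k} {P Q : Set G} (v : G)
    (hv : χ (.ofAdd v) ≠ 1) (hP : ∀ x, x - v ∈ P → x ∈ P)
    (hQ : ∀ x, x ∈ Q ↔ x ∈ P ∧ x - v ∉ P) (h : RegZero (wInd χ Q)) : RegZero (wInd χ P) := by
  refine RegZero.of_conv (h := 1 - single v (χ (.ofAdd v))) ?_ ?_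
  · rw [aug_one_sub_single]
    exact sub_ne_zero.2 hv.symm
  · rw [conv_wInd χ hP]
    rwa [Set.ext hQ] at h

theorem Reg.peel {χ : Multiplicative G →* k} {P Q : Set G} (v : G)
    (hP : ∀ x, x - v ∈ P → x ∈ P)
    (hQ : ∀ x, x ∈ Q ↔ x ∈ P ∧ x - v ∉ P) (h : Reg (wInd χ P)) : Reg (wInd χ Q) := by
  have := h.conv (1 - single v (χ (.ofAdd v)))
  rw [conv_wInd χ hP] at this
  rwa [Set.ext hQ]

/-- A set that is invariant under a translation of nontrivial weight has regularized sum zero. -/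
theorem RegZero.of_translate {χ : Multiplicative G →* k} {P : Set G} (v : G)
    (hv : χ (.ofAdd v) ≠ 1) (hP : ∀ x, x - v ∈ P ↔ x ∈ P) : RegZero (wInd χ P) := by
  refine RegZero.of_peel (Q := ∅) v hv (fun x => (hP x).1) ?_ ?_
  · intro x
    simp [hP]
  · have : wInd χ (∅ : Set G) = 0 := by
      funext x
      simp [wInd]
    rw [this]
    exact regZero_zero

end Regularization

/-! ### Rationality of order cones -/

section OrderCone

set_option linter.unusedSectionVars false

open AddMonoidAlgebra

variable {ι k : Type*} [CommRing k] [IsDomain k]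

/-- The integer points `x` supported on `D` with `x o = 0` and `x w ≤ x u` for all pairs
`(u, w)` in `R`. -/
def orderCone (D : Finset ι) (o : ι) (R : Finset (ι × ι)) : Set (ι → ℤ) :=
  {x | (∀ u, u ∉ D → x u = 0) ∧ x o = 0 ∧ ∀ e ∈ R, x e.2 ≤ x e.1}

theorem mem_orderCone {D : Finset ι} {o : ι} {R : Finset (ι × ι)} {x : ι → ℤ} :
    x ∈ orderCone D o R ↔ (∀ u, u ∉ D → x u = 0) ∧ x o = 0 ∧ ∀ e ∈ R, x e.2 ≤ x e.1 :=
  Iff.rfl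

open Classical in
/-- The indicator vector of a set. -/
noncomputable def ind (J : Set ι) : ι → ℤ := fun u => if u ∈ J then 1 else 0

/-- The primitive generators of rays of the simplicial cones into which order cones decompose:
the vectors `± ind J` for nonempty `J ⊆ D \ {o}`. -/
def IsRay (D : Finset ι) (o : ι) (v : ι → ℤ) : Prop :=
  ∃ J : Set ι, J ⊆ D ∧ J.Nonempty ∧ o ∉ J ∧ (v = ind J ∨ v = -ind J)

/-- The monoid of products of denominators `1 - χ v • t ^ v`, where `v` is a ray. -/
noncomputable def denominators (χ : Multiplicative (ι → ℤ) →* k) (D : Finset ι) (o : ι) :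
    Submonoid (AddMonoidAlgebra k (ι → ℤ)) :=
  Submonoid.closure {q | ∃ v, IsRay D o v ∧ q = 1 - single v (χ (.ofAdd v))}

/-- The functions that become finitely supported after convolution with a product of
denominators `1 - χ v • t ^ v`. -/
def IsRational (χ : Multiplicative (ι → ℤ) →* k) (D : Finset ι) (o : ι) (f : (ι → ℤ) → k) : Prop :=
  ∃ q ∈ denominators χ D o, ∃ p : AddMonoidAlgebra k (ι → ℤ), conv q f = fun a => p.coeff a

variable {χ : Multiplicative (ι → ℤ) →* k} {D : Finset ι} {o : ι}

theorem IsRational.add {f g : (ι → ℤ) → k} (hf : IsRational χ D o f) (hg : IsRational χ D o g) :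
    IsRational χ D o (f + g) := by
  obtain ⟨q, hq, p, e⟩ := hf
  obtain ⟨q', hq', p', e'⟩ := hg
  refine ⟨q * q', mul_mem hq hq', q' * p + q * p', ?_⟩
  rw [conv_add_right, conv_mul q q' g, mul_comm q q', conv_mul q' q f, e, e', conv_coeff,
    conv_coeff]
  funext a
  simp

theorem IsRational.neg {f : (ι → ℤ) → k} (hf : IsRational χ D o f) : IsRational χ D o (-f) := by
  obtain ⟨q, hq, p, e⟩ := hf
  refine ⟨q, hq, -p, ?_⟩
  rw [conv_neg_right, e]
  funext a
  simp

theorem IsRational.of_conv {f : (ι → ℤ) → k} {v : ι → ℤ} (hv : IsRay D o v)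
    (hf : IsRational χ D o (conv (1 - single v (χ (.ofAdd v))) f)) : IsRational χ D o f := by
  obtain ⟨q, hq, p, e⟩ := hf
  exact ⟨q * (1 - single v (χ (.ofAdd v))),
    mul_mem hq (Submonoid.subset_closure ⟨v, hv, rfl⟩), p, by rw [conv_mul, e]⟩

theorem isRational_singleton_zero : IsRational χ D o (wInd χ {0}) := by
  classical
  refine ⟨1, one_mem _, single 0 1, ?_⟩
  funext a
  rw [conv_one, wInd]
  by_cases ha : a = 0
  · subst ha
    simp
  · simp [ha]

theorem orderCone_insert_of_imp [DecidableEq ι] {R : Finset (ι × ι)} {e : ι × ι}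
    (h : ∀ x ∈ orderCone D o R, x e.2 ≤ x e.1) :
    orderCone D o (insert e R) = orderCone D o R := by
  ext x
  constructor
  · exact fun hx => ⟨hx.1, hx.2.1, fun e he => hx.2.2 e (Finset.mem_insert_of_mem he)⟩
  · intro hx
    refine ⟨hx.1, hx.2.1, fun e' he' => ?_⟩
    rcases Finset.mem_insert.1 he' with rfl | h'
    · exact h x hx
    · exact hx.2.2 e' h'

theorem mem_orderCone_insert [DecidableEq ι] {R : Finset (ι × ι)} {e : ι × ι} {x : ι → ℤ} :
    x ∈ orderCone D o (insert e R) ↔ x ∈ orderCone D o R ∧ x e.2 ≤ x e.1 := by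
  simp only [mem_orderCone, Finset.forall_mem_insert]
  tauto

/-- Inclusion-exclusion for the two halves of an order cone cut out by comparing two
coordinates. -/
theorem wInd_orderCone_split [DecidableEq ι] (R : Finset (ι × ι)) (u w : ι) :
    wInd χ (orderCone D o R) = wInd χ (orderCone D o (insert (u, w) R)) +
      (wInd χ (orderCone D o (insert (w, u) R)) +
        -wInd χ (orderCone D o (insert (w, u) (insert (u, w) R)))) := by
  classical
  funext x
  simp only [wInd, Pi.add_apply, Pi.neg_apply, mem_orderCone_insert]
  by_cases hx : x ∈ orderCone D o R
  · rcases lt_trichotomy (x u) (x w) with h | h | h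
    · simp [hx, h.le, h.not_ge]
    · simp [hx, h]
    · simp [hx, h.le, h.not_ge]
  · simp [hx]

/-- For a total preorder `R` on `D` in which `u` is a minimal element of an upper set `J` and `w` a
maximal element of its complement, multiplication by a single denominator restricts the order cone
to the facet `x u = x w`. -/
theorem exists_ray_of_cut [DecidableEq ι] {R : Finset (ι × ι)} (hR : R ⊆ D ×ˢ D)
    {J : Set ι} {u w : ι} (hJ : J ⊆ D) (hu : u ∈ J) (hwD : w ∈ D) (hw : w ∉ J) (huw : (u, w) ∈ R)
    (hup : ∀ e ∈ R, e.2 ∈ J → e.1 ∈ J) (hmin : ∀ v ∈ J, (v, u) ∈ R)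
    (hmax : ∀ v ∈ D, v ∉ J → (w, v) ∈ R) :
    ∃ v, IsRay D o v ∧ (∀ x, x - v ∈ orderCone D o R → x ∈ orderCone D o R) ∧
      ∀ x, x ∈ orderCone D o (insert (w, u) R) ↔
        x ∈ orderCone D o R ∧ x - v ∉ orderCone D o R := by
  classical
  -- The ray is `ind J` or `-ind (D \ J)`, whichever vanishes at `o`; both increase the
  -- coordinates of `J` by one relative to the other coordinates.
  obtain ⟨v, s, hv, hvD, hvo, hvJ⟩ : ∃ (v : ι → ℤ) (s : ℤ), IsRay D o v ∧ (∀ u ∉ D, v u = 0) ∧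
      v o = 0 ∧ ∀ u ∈ D, v u = s + if u ∈ J then 1 else 0 := by
    by_cases hoJ : o ∈ J
    · refine ⟨-ind (D \ J), -1, ⟨D \ J, Set.sdiff_subset, ⟨w, hwD, hw⟩, fun h => h.2 hoJ, .inr rfl⟩,
        fun a ha => ?_, ?_, fun a ha => ?_⟩
      · simp [ind, ha]
      · simp [ind, hoJ]
      · by_cases haJ : a ∈ J <;> simp [ind, ha, haJ]
    · refine ⟨ind J, 0, ⟨J, hJ, ⟨u, hu⟩, hoJ, .inl rfl⟩, fun a ha => ?_, ?_, fun a ha => ?_⟩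
      · have haJ : a ∉ J := fun h => ha (hJ h)
        simp [ind, haJ]
      · simp [ind, hoJ]
      · simp [ind]
  have hmem : ∀ e ∈ R, e.1 ∈ D ∧ e.2 ∈ D := fun e he => Finset.mem_product.1 (hR he)
  have hsub : ∀ x, x - v ∈ orderCone D o R → x ∈ orderCone D o R := by
    intro x hx
    refine ⟨fun a ha => ?_, ?_, fun e he => ?_⟩
    · have := hx.1 a ha
      rwa [Pi.sub_apply, hvD a ha, sub_zero] at this
    · have := hx.2.1
      rwa [Pi.sub_apply, hvo, sub_zero] at this
    · have h := hx.2.2 e he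
      rw [Pi.sub_apply, Pi.sub_apply, hvJ _ (hmem e he).1, hvJ _ (hmem e he).2] at h
      have := hup e he
      split_ifs at h <;> first | omega | exact absurd (this ‹_›) ‹_›
  refine ⟨v, hv, hsub, fun x => ?_⟩
  rw [mem_orderCone_insert]
  refine and_congr_right fun hx => ⟨fun h hxv => ?_, fun h => ?_⟩
  · have h' := hxv.2.2 _ huw
    rw [Pi.sub_apply, Pi.sub_apply, hvJ _ (hJ hu), hvJ _ hwD, if_pos hu, if_neg hw] at h'
    simp only at h h'
    omega
  · by_contra hlt
    simp only at hlt
    refine h ⟨fun a ha => ?_, ?_, fun e he => ?_⟩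
    · rw [Pi.sub_apply, hvD a ha, hx.1 a ha, sub_zero]
    · rw [Pi.sub_apply, hvo, hx.2.1, sub_zero]
    · have h0 := hx.2.2 e he
      rw [Pi.sub_apply, Pi.sub_apply, hvJ _ (hmem e he).1, hvJ _ (hmem e he).2]
      split_ifs with h1 h2 h2
      · omega
      · exact absurd (hup e he h1) h2
      · have h3 := hx.2.2 _ (hmin _ h2)
        have h4 := hx.2.2 _ (hmax _ (hmem e he).2 h1)
        simp only at h3 h4
        omega
      · omega

/-- The generating function of an order cone is rational. Incomparable pairs are removed by
inclusion-exclusion; when all pairs are comparable, the cone is simplicial and its facets have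
fewer distinct coordinates. -/
theorem isRational_orderCone (ho : o ∈ D) (R : Finset (ι × ι)) (hR : R ⊆ D ×ˢ D) :
    IsRational χ D o (wInd χ (orderCone D o R)) := by
  classical
  induction hn : (D ×ˢ D \ R).card using Nat.strong_induction_on generalizing R with
  | _ n ih =>
  subst hn
  have step : ∀ e : ι × ι, e ∈ D ×ˢ D → e ∉ R → ∀ R' : Finset (ι × ι), R ⊆ R' → e ∈ R' →
      R' ⊆ D ×ˢ D → IsRational χ D o (wInd χ (orderCone D o R')) := by
    intro e he heR R' hRR' heR' hR'
    refine ih _ (Finset.card_lt_card ?_) R' hR' rfl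
    refine ⟨Finset.sdiff_subset_sdiff subset_rfl hRR', fun h => ?_⟩
    exact (Finset.mem_sdiff.1 (h (Finset.mem_sdiff.2 ⟨he, heR⟩))).2 heR'
  have step1 : ∀ e : ι × ι, e ∈ D ×ˢ D → e ∉ R →
      IsRational χ D o (wInd χ (orderCone D o (insert e R))) := fun e he heR =>
    step e he heR _ (Finset.subset_insert _ _) (Finset.mem_insert_self _ _)
      (Finset.insert_subset he hR)
  by_cases htot : ∀ u ∈ D, ∀ w ∈ D, (u, w) ∈ R ∨ (w, u) ∈ R
  swap
  · push Not at htot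
    obtain ⟨u, hu, w, hw, h1, h2⟩ := htot
    have huw : (u, w) ∈ D ×ˢ D := Finset.mk_mem_product hu hw
    have hwu : (w, u) ∈ D ×ˢ D := Finset.mk_mem_product hw hu
    rw [wInd_orderCone_split R u w]
    refine (step1 _ huw h1).add ((step1 _ hwu h2).add (IsRational.neg ?_))
    exact step _ huw h1 _ ((Finset.subset_insert _ _).trans (Finset.subset_insert _ _))
      (Finset.mem_insert_of_mem (Finset.mem_insert_self _ _))
      (Finset.insert_subset hwu (Finset.insert_subset huw hR))
  by_cases htrans : ∀ a b c, (a, b) ∈ R → (b, c) ∈ R → (a, c) ∈ R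
  swap
  · push Not at htrans
    obtain ⟨a, b, c, hab, hbc, hac⟩ := htrans
    have hac' : (a, c) ∈ D ×ˢ D := Finset.mk_mem_product
      (Finset.mem_product.1 (hR hab)).1 (Finset.mem_product.1 (hR hbc)).2
    have h := step1 _ hac' hac
    rwa [orderCone_insert_of_imp] at h
    exact fun x hx => (hx.2.2 _ hbc).trans (hx.2.2 _ hab)
  -- From here on `R` is a total preorder on `D`; if all its elements are equivalent, the cone is a
  -- point.
  by_cases huniv : ∀ u ∈ D, ∀ w ∈ D, (w, u) ∈ R
  · have : orderCone D o R = {0} := by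
      ext x
      constructor
      · intro hx
        funext u
        by_cases hu : u ∈ D
        · have h1 := hx.2.2 _ (huniv u hu o ho)
          have h2 := hx.2.2 _ (huniv o ho u hu)
          have h3 := hx.2.1
          simp only [Pi.zero_apply] at *
          omega
        · exact hx.1 u hu
      · rintro rfl
        exact ⟨fun _ _ => rfl, rfl, fun _ _ => le_rfl⟩
    rw [this]
    exact isRational_singleton_zero
  · push Not at huniv
    obtain ⟨u, hu, w₁, hw₁, hw₁u⟩ := huniv
    -- The upper set generated by `u`, and a maximal element `w` of its complement: one with the
    -- largest set of elements below it.
    obtain ⟨w, hwm, hmax⟩ := Finset.exists_max_image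
      (D.filter fun v => (v, u) ∉ R) (fun v => (D.filter fun y => (v, y) ∈ R).card)
      ⟨w₁, Finset.mem_filter.2 ⟨hw₁, hw₁u⟩⟩
    obtain ⟨hw, hwu⟩ := Finset.mem_filter.1 hwm
    have hmax' : ∀ v ∈ D, (v, u) ∉ R → (w, v) ∈ R := by
      intro v hv hvu
      by_contra hwv
      have hvw := (htot v hv w hw).resolve_right hwv
      have hle := hmax v (Finset.mem_filter.2 ⟨hv, hvu⟩)
      refine absurd hle (not_le.2 (Finset.card_lt_card ⟨fun y hy => ?_, fun hsub => ?_⟩))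
      · rw [Finset.mem_filter] at hy ⊢
        exact ⟨hy.1, htrans _ _ _ hvw hy.2⟩
      · exact hwv (Finset.mem_filter.1
          (hsub (Finset.mem_filter.2 ⟨hv, (htot v hv v hv).elim id id⟩))).2
    obtain ⟨v, hv, hsub, hcut⟩ := exists_ray_of_cut (o := o) (R := R) hR
      (J := {v | (v, u) ∈ R}) (u := u) (w := w)
      (fun v hv => (Finset.mem_product.1 (hR hv)).1) ((htot u hu u hu).elim id id) hw hwu
      ((htot u hu w hw).resolve_right hwu) (fun e he h => htrans _ _ _ he h) (fun v hv => hv) hmax'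
    refine IsRational.of_conv hv ?_
    rw [conv_wInd χ hsub]
    have h := step1 (w, u) (Finset.mk_mem_product hw hu) hwu
    rwa [Set.ext hcut] at h

end OrderCone

/-! ### Row weights and Gelfand–Tsetlin cones in the plane -/

section RowWeights

variable {ι K : Type*} [Field K]

/-- The vector of row sums of `x` over the index set `E`; the row of `u : ι` is `row u`. -/
noncomputable def rowSum (row : ι → ℤ) (E : Finset ι) : (ι → ℤ) →+ (ℤ →₀ ℤ) where
  toFun x := ∑ u ∈ E, Finsupp.single (row u) (x u)
  map_zero' := by simp
  map_add' x y := by simp [Finset.sum_add_distrib]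

theorem rowSum_apply (row : ι → ℤ) (E : Finset ι) (x : ι → ℤ) (r : ℤ) :
    rowSum row E x r = ∑ u ∈ E, if row u = r then x u else 0 := by
  simp [rowSum, Finsupp.finsetSum_apply, Finsupp.single_apply]

/-- The character of `ι → ℤ` that depends only on the row sums, through `ψ`. -/
noncomputable def rowWeight (row : ι → ℤ) (E : Finset ι) (ψ : Multiplicative (ℤ →₀ ℤ) →* K) :
    Multiplicative (ι → ℤ) →* K :=
  ψ.comp (AddMonoidHom.toMultiplicative (rowSum row E))

theorem rowWeight_apply (row : ι → ℤ) (E : Finset ι) (ψ : Multiplicative (ℤ →₀ ℤ) →* K)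
    (x : ι → ℤ) : rowWeight row E ψ (.ofAdd x) = ψ (.ofAdd (rowSum row E x)) :=
  rfl

theorem rowSum_ind_ne_zero (row : ι → ℤ) {E : Finset ι} {J : Set ι} (hJ : J ⊆ E)
    (hne : J.Nonempty) : rowSum row E (ind J) ≠ 0 := by
  obtain ⟨j, hj⟩ := hne
  intro h
  have h' := DFunLike.congr_fun h (row j)
  rw [rowSum_apply, Finsupp.coe_zero, Pi.zero_apply] at h'
  refine absurd h' (ne_of_gt (Finset.sum_pos' (fun u _ => ?_) ⟨j, hJ hj, ?_⟩))
  · unfold ind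
    split_ifs <;> norm_num
  · simp [ind, hj]

theorem rowWeight_ne_one {row : ι → ℤ} {E : Finset ι} {ψ : Multiplicative (ℤ →₀ ℤ) →* K}
    (hψ : Function.Injective ψ) {x : ι → ℤ} (hx : rowSum row E x ≠ 0) :
    rowWeight row E ψ (.ofAdd x) ≠ 1 := by
  rw [rowWeight_apply, ← map_one ψ]
  exact fun h => hx (hψ h)

theorem rowWeight_ind_ne_one {row : ι → ℤ} {E : Finset ι} {ψ : Multiplicative (ℤ →₀ ℤ) →* K}
    (hψ : Function.Injective ψ) {J : Set ι} (hJ : J ⊆ E) (hne : J.Nonempty) :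
    rowWeight row E ψ (.ofAdd (ind J)) ≠ 1 :=
  rowWeight_ne_one hψ (rowSum_ind_ne_zero row hJ hne)

/-- Weighted order cones have regularized sums, since the denominators do not vanish. -/
theorem reg_orderCone {row : ι → ℤ} {E : Finset ι} {ψ : Multiplicative (ℤ →₀ ℤ) →* K}
    (hψ : Function.Injective ψ) {D : Finset ι} (hDE : D ⊆ E) {o : ι} (ho : o ∈ D)
    {R : Finset (ι × ι)} (hR : R ⊆ D ×ˢ D) :
    Reg (wInd (rowWeight row E ψ) (orderCone D o R)) := by
  obtain ⟨q, hq, p, e⟩ := isRational_orderCone (χ := rowWeight row E ψ) ho R hR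
  refine ⟨q, p, ?_, e⟩
  clear e
  induction hq using Submonoid.closure_induction with
  | mem q hq =>
    obtain ⟨v, ⟨J, hJ, hne, -, hv⟩, rfl⟩ := hq
    rw [aug_one_sub_single]
    refine sub_ne_zero.2 (Ne.symm (rowWeight_ne_one hψ ?_))
    have hJE := rowSum_ind_ne_zero row (hJ.trans (Finset.coe_subset.2 hDE)) hne
    rcases hv with rfl | rfl
    · exact hJE
    · rw [map_neg]
      exact neg_ne_zero.2 hJE
  | one =>
    rw [map_one]
    exact one_ne_zero
  | mul p q _ _ hp hq =>
    rw [map_mul]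
    exact mul_ne_zero hp hq

end RowWeights

/-- The inequalities of Gelfand–Tsetlin patterns between the nodes of `D`: the pairs `(u, w)`
with `w` the lower right neighbor of `u`, or `w` the upper right neighbor of `u`. -/
def gtRel (D : Finset (ℤ × ℤ)) : Finset ((ℤ × ℤ) × (ℤ × ℤ)) :=
  (D ×ˢ D).filter fun e => e.2 = (e.1.1 + 1, e.1.2) ∨ e.2 = (e.1.1 - 1, e.1.2 + 1)

/-- The points supported on `D` that satisfy the Gelfand–Tsetlin inequalities within `D` and
vanish at `o`. -/
def gtCone (D : Finset (ℤ × ℤ)) (o : ℤ × ℤ) : Set (ℤ × ℤ → ℤ) :=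
  orderCone D o (gtRel D)

theorem mem_gtRel {D : Finset (ℤ × ℤ)} {e : (ℤ × ℤ) × (ℤ × ℤ)} : e ∈ gtRel D ↔
    (e.1 ∈ D ∧ e.2 ∈ D) ∧ (e.2 = (e.1.1 + 1, e.1.2) ∨ e.2 = (e.1.1 - 1, e.1.2 + 1)) := by
  rw [gtRel, Finset.mem_filter, Finset.mem_product]

theorem gtRel_subset (D : Finset (ℤ × ℤ)) : gtRel D ⊆ D ×ˢ D :=
  Finset.filter_subset _ _

/-- The effect on row sums of the reflection of row `i`: the sum of row `i` is replaced by the sum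
of the two neighboring rows minus itself. -/
noncomputable def reflect (i : ℤ) : (ℤ →₀ ℤ) →+ (ℤ →₀ ℤ) where
  toFun s := s + Finsupp.single i (s (i - 1) + s (i + 1) - 2 * s i)
  map_zero' := by simp
  map_add' s t := by
    have : (s + t) (i - 1) + (s + t) (i + 1) - 2 * (s + t) i =
        (s (i - 1) + s (i + 1) - 2 * s i) + (t (i - 1) + t (i + 1) - 2 * t i) := by
      simp only [Finsupp.add_apply]
      ring
    rw [this, Finsupp.single_add]
    abel

theorem reflect_apply_self (i : ℤ) (s : ℤ →₀ ℤ) :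
    reflect i s i = s (i - 1) + s (i + 1) - s i := by
  simp [reflect]
  ring

theorem reflect_apply_of_ne {i r : ℤ} (h : r ≠ i) (s : ℤ →₀ ℤ) : reflect i s r = s r := by
  simp [reflect, Ne.symm h]

theorem reflect_reflect (i : ℤ) (s : ℤ →₀ ℤ) : reflect i (reflect i s) = s := by
  ext r
  by_cases h : r = i
  · subst h
    rw [reflect_apply_self, reflect_apply_self, reflect_apply_of_ne (by omega),
      reflect_apply_of_ne (by omega)]
    ring
  · rw [reflect_apply_of_ne h, reflect_apply_of_ne h]

theorem injective_comp_reflect {K : Type*} [Field K] {ψ : Multiplicative (ℤ →₀ ℤ) →* K}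
    (hψ : Function.Injective ψ) (i : ℤ) :
    Function.Injective (ψ.comp (AddMonoidHom.toMultiplicative (reflect i))) := by
  intro s t h
  have h' : reflect i s.toAdd = reflect i t.toAdd := hψ h
  have := congrArg (reflect i) h'
  rwa [reflect_reflect, reflect_reflect] at this

theorem rowSum_eq_sum_Icc {D E : Finset (ℤ × ℤ)} (hDE : D ⊆ E) {x : ℤ × ℤ → ℤ}
    (hx : ∀ u, u ∉ D → x u = 0) {r l h : ℤ} (hr : ∀ c, (r, c) ∈ D ↔ l ≤ c ∧ c ≤ h) :
    rowSum Prod.fst E x r = ∑ c ∈ Finset.Icc l h, x (r, c) := by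
  rw [rowSum_apply, ← Finset.sum_filter]
  refine Eq.trans (Eq.symm ?_)
    (Finset.sum_map (Finset.Icc l h) ⟨Prod.mk r, Prod.mk_right_injective r⟩ x)
  apply Finset.sum_subset
  · intro u hu
    simp only [Finset.mem_map, Finset.mem_Icc, Function.Embedding.coeFn_mk] at hu
    obtain ⟨c, hc, rfl⟩ := hu
    exact Finset.mem_filter.2 ⟨hDE ((hr c).2 hc), rfl⟩
  · rintro ⟨r', c⟩ hu hu'
    obtain ⟨-, rfl⟩ := Finset.mem_filter.1 hu
    refine hx _ fun h => hu' ?_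
    simp only [Finset.mem_map, Finset.mem_Icc, Function.Embedding.coeFn_mk]
    exact ⟨c, (hr c).1 h, rfl⟩

/-! ### The reflection of a row -/

section Toggle

/-- Row `i` of `D` has columns `a, …, b` with `a < b`, and projects on both sides half a step beyond
row `i - 1`. Row `i + 1` has columns `a', …, b'`, and each of its ends lies half a step inside or half
a step outside the corresponding end of row `i`. -/
structure IsWideRow (D : Finset (ℤ × ℤ)) (i a b a' b' : ℤ) : Prop where
  row : ∀ c, (i, c) ∈ D ↔ a ≤ c ∧ c ≤ b
  prev : ∀ c, (i - 1, c) ∈ D ↔ a + 1 ≤ c ∧ c ≤ b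
  next : ∀ c, (i + 1, c) ∈ D ↔ a' ≤ c ∧ c ≤ b'
  lt : a < b
  left : a' = a ∨ a' = a - 1
  right : b' = b ∨ b' = b - 1

/-- The subset of `D` obtained by deleting the leftmost node of row `i` if it has no left neighbor,
and the rightmost node of row `i` if it has no right neighbor. -/
def trim (D : Finset (ℤ × ℤ)) (i a b a' b' : ℤ) : Finset (ℤ × ℤ) :=
  D.filter fun v => ¬(v = (i, a) ∧ a' = a) ∧ ¬(v = (i, b) ∧ b' = b - 1)

/-- The maximum of the right neighbors of the node `(i, c)` of a wide row that ends in
column `b`. -/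
def lo (i b : ℤ) (x : ℤ × ℤ → ℤ) (c : ℤ) : ℤ :=
  if c < b then max (x (i - 1, c + 1)) (x (i + 1, c)) else x (i + 1, b)

/-- The minimum of the left neighbors of the node `(i, c)` of a wide row that starts in
column `a`. -/
def up (i a : ℤ) (x : ℤ × ℤ → ℤ) (c : ℤ) : ℤ :=
  if a < c then min (x (i - 1, c)) (x (i + 1, c - 1)) else x (i + 1, a - 1)

theorem lo_congr {i b : ℤ} {x y : ℤ × ℤ → ℤ} (h : ∀ v : ℤ × ℤ, v.1 ≠ i → x v = y v) (c : ℤ) :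
    lo i b x c = lo i b y c := by
  simp only [lo]
  rw [h (i - 1, c + 1) (by simp), h (i + 1, c) (by simp), h (i + 1, b) (by simp)]

theorem up_congr {i a : ℤ} {x y : ℤ × ℤ → ℤ} (h : ∀ v : ℤ × ℤ, v.1 ≠ i → x v = y v) (c : ℤ) :
    up i a x c = up i a y c := by
  simp only [up]
  rw [h (i - 1, c) (by simp), h (i + 1, c - 1) (by simp), h (i + 1, a - 1) (by simp)]

/-- The piecewise linear reflection of every entry of row `i`, columns `a, …, b`, in the middle of
the interval allowed by its neighbors. -/
def reflectRow (i a b : ℤ) (x : ℤ × ℤ → ℤ) : ℤ × ℤ → ℤ :=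
  fun v => if v.1 = i ∧ a ≤ v.2 ∧ v.2 ≤ b then lo i b x v.2 + up i a x v.2 - x v else x v

theorem reflectRow_of_ne {i a b : ℤ} (x : ℤ × ℤ → ℤ) {v : ℤ × ℤ} (h : v.1 ≠ i) :
    reflectRow i a b x v = x v :=
  if_neg fun h' => h h'.1

theorem reflectRow_of_mem {i a b c : ℤ} (x : ℤ × ℤ → ℤ) (h : a ≤ c ∧ c ≤ b) :
    reflectRow i a b x (i, c) = lo i b x c + up i a x c - x (i, c) :=
  if_pos ⟨rfl, h⟩

theorem reflectRow_involutive (i a b : ℤ) : Function.Involutive (reflectRow i a b) := by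
  intro x
  have hne : ∀ v : ℤ × ℤ, v.1 ≠ i → reflectRow i a b x v = x v := fun v => reflectRow_of_ne x
  funext v
  by_cases hv : v.1 = i ∧ a ≤ v.2 ∧ v.2 ≤ b
  · obtain ⟨r, c⟩ := v
    obtain ⟨rfl, hc⟩ := hv
    rw [reflectRow_of_mem _ hc, reflectRow_of_mem _ hc, lo_congr hne, up_congr hne]
    ring
  · rw [reflectRow, if_neg hv, reflectRow, if_neg hv]

variable {D : Finset (ℤ × ℤ)} {o : ℤ × ℤ} {i a b a' b' : ℤ}

theorem mem_trim {v : ℤ × ℤ} : v ∈ trim D i a b a' b' ↔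
    v ∈ D ∧ ¬(v = (i, a) ∧ a' = a) ∧ ¬(v = (i, b) ∧ b' = b - 1) :=
  Finset.mem_filter

theorem trim_subset : trim D i a b a' b' ⊆ D :=
  Finset.filter_subset _ _

theorem mem_trim_of_ne {v : ℤ × ℤ} (h : v.1 ≠ i) : v ∈ trim D i a b a' b' ↔ v ∈ D := by
  rw [mem_trim]
  refine ⟨fun h => h.1, fun hv => ⟨hv, ?_, ?_⟩⟩ <;>
  · rintro ⟨rfl, -⟩
    exact h rfl

theorem IsWideRow.mem_trim_row (hD : IsWideRow D i a b a' b') {c : ℤ} :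
    (i, c) ∈ trim D i a b a' b' ↔
      (a ≤ c ∧ c ≤ b) ∧ (a < c ∨ a' = a - 1) ∧ (c < b ∨ b' = b) := by
  have := hD.left
  have := hD.right
  rw [mem_trim, hD.row, Prod.mk.injEq, Prod.mk.injEq]
  omega

/-- The inequalities that involve row `i` bound each entry of this row separately; this applies to
`D` and to the set obtained by trimming row `i`. -/
theorem IsWideRow.mem_gtCone_iff (hD : IsWideRow D i a b a' b') {D' : Finset (ℤ × ℤ)}
    (hD' : D' ⊆ D) (hrow : ∀ v : ℤ × ℤ, v.1 ≠ i → (v ∈ D' ↔ v ∈ D)) {x : ℤ × ℤ → ℤ} :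
    x ∈ gtCone D' o ↔ (∀ u, u ∉ D' → x u = 0) ∧ x o = 0 ∧
      (∀ e ∈ gtRel D, e.1.1 ≠ i → e.2.1 ≠ i → x e.2 ≤ x e.1) ∧
      ∀ c, (i, c) ∈ D' → ((c < b ∨ b' = b) → lo i b x c ≤ x (i, c)) ∧
        ((a < c ∨ a' = a - 1) → x (i, c) ≤ up i a x c) := by
  have hl := hD.left
  have hr := hD.right
  have hlt := hD.lt
  have hprev : ∀ c, (i - 1, c) ∈ D' ↔ a + 1 ≤ c ∧ c ≤ b := fun c =>
    (hrow (i - 1, c) (by simp)).trans (hD.prev c)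
  have hnext : ∀ c, (i + 1, c) ∈ D' ↔ a' ≤ c ∧ c ≤ b' := fun c =>
    (hrow (i + 1, c) (by simp)).trans (hD.next c)
  have hmem : ∀ c, (i, c) ∈ D' → a ≤ c ∧ c ≤ b := fun c hc => (hD.row c).1 (hD' hc)
  constructor
  · intro hx
    refine ⟨hx.1, hx.2.1, fun e he h1 h2 => ?_, fun c hc => ⟨fun h => ?_, fun h => ?_⟩⟩
    · rw [mem_gtRel] at he
      exact hx.2.2 e (mem_gtRel.2 ⟨⟨(hrow _ h1).2 he.1.1, (hrow _ h2).2 he.1.2⟩, he.2⟩)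
    · have hc' := hmem c hc
      unfold lo
      split_ifs with hcb
      · refine max_le ?_ ?_
        · exact hx.2.2 ((i, c), (i - 1, c + 1))
            (mem_gtRel.2 ⟨⟨hc, (hprev _).2 (by omega)⟩, .inr rfl⟩)
        · exact hx.2.2 ((i, c), (i + 1, c))
            (mem_gtRel.2 ⟨⟨hc, (hnext _).2 (by omega)⟩, .inl rfl⟩)
      · obtain rfl : c = b := by omega
        exact hx.2.2 ((i, c), (i + 1, c))
          (mem_gtRel.2 ⟨⟨hc, (hnext _).2 (by omega)⟩, .inl rfl⟩)
    · have hc' := hmem c hc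
      unfold up
      split_ifs with hca
      · refine le_min ?_ ?_
        · exact hx.2.2 ((i - 1, c), (i, c))
            (mem_gtRel.2 ⟨⟨(hprev _).2 (by omega), hc⟩, .inl (by simp)⟩)
        · exact hx.2.2 ((i + 1, c - 1), (i, c))
            (mem_gtRel.2 ⟨⟨(hnext _).2 (by omega), hc⟩, .inr (by simp)⟩)
      · obtain rfl : c = a := by omega
        exact hx.2.2 ((i + 1, c - 1), (i, c))
          (mem_gtRel.2 ⟨⟨(hnext _).2 (by omega), hc⟩, .inr (by simp)⟩)
  · rintro ⟨h1, h2, h3, h4⟩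
    refine ⟨h1, h2, ?_⟩
    rintro ⟨⟨r, c⟩, ⟨r', c'⟩⟩ he
    obtain ⟨⟨hu, hw⟩, he'⟩ := mem_gtRel.1 he
    simp only [Prod.mk.injEq] at hu hw he' ⊢
    by_cases hri : r = i
    · subst hri
      have hc := hmem c hu
      have hlo := (h4 c hu).1
      rcases he' with ⟨rfl, rfl⟩ | ⟨rfl, rfl⟩
      · have := (hnext c').1 hw
        refine le_trans ?_ (hlo (by omega))
        unfold lo
        split_ifs with hcb
        · exact le_max_right _ _
        · obtain rfl : c' = b := by omega
          exact le_rfl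
      · have := (hprev _).1 hw
        refine le_trans ?_ (hlo (by omega))
        unfold lo
        rw [if_pos (by omega)]
        exact le_max_left _ _
    by_cases hri' : r' = i
    · subst hri'
      have hc := hmem c' hw
      have hup := (h4 c' hw).2
      rcases he' with ⟨h5, rfl⟩ | ⟨h5, h6⟩
      · obtain rfl : r = r' - 1 := by omega
        have := (hprev _).1 hu
        refine le_trans (hup (by omega)) ?_
        unfold up
        rw [if_pos (by omega)]
        exact min_le_left _ _
      · obtain rfl : r = r' + 1 := by omega
        obtain rfl : c = c' - 1 := by omega
        have := (hnext _).1 hu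
        refine le_trans (hup (by omega)) ?_
        unfold up
        split_ifs with hcb
        · exact min_le_right _ _
        · obtain rfl : c' = a := by omega
          exact le_rfl
    · exact h3 ((r, c), (r', c')) (mem_gtRel.2 ⟨⟨hD' hu, hD' hw⟩, (mem_gtRel.1 he).2⟩) hri hri'

/-- The sum of all interval midpoints of row `i`, doubled, is the sum of the neighboring rows:
the maximum and the minimum of the two common neighbors of adjacent nodes add up to their sum. -/
theorem IsWideRow.sum_lo_add_up (hD : IsWideRow D i a b a' b') {x : ℤ × ℤ → ℤ}
    (hx : ∀ u, u ∉ D → x u = 0) :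
    ∑ c ∈ Finset.Icc a b, (lo i b x c + up i a x c) =
      ∑ c ∈ Finset.Icc (a + 1) b, x (i - 1, c) + ∑ c ∈ Finset.Icc a' b', x (i + 1, c) := by
  have hl := hD.left
  have hr := hD.right
  have hlt := hD.lt
  have e1 : Finset.Icc a b = insert b (Finset.Icc a (b - 1)) := by
    ext c
    simp only [Finset.mem_Icc, Finset.mem_insert]
    omega
  have e2 : Finset.Icc a b = insert a (Finset.Icc (a + 1) b) := by
    ext c
    simp only [Finset.mem_Icc, Finset.mem_insert]
    omega
  have shift : ∀ f : ℤ → ℤ,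
      ∑ c ∈ Finset.Icc (a + 1) b, f c = ∑ c ∈ Finset.Icc a (b - 1), f (c + 1) := by
    intro f
    refine Finset.sum_nbij' (fun c => c - 1) (fun c => c + 1) ?_ ?_ ?_ ?_ ?_ <;>
      simp
  have e3 : ∑ c ∈ Finset.Icc a' b', x (i + 1, c) = ∑ c ∈ Finset.Icc (a - 1) b, x (i + 1, c) := by
    refine Finset.sum_subset (Finset.Icc_subset_Icc (by omega) (by omega)) fun c _ hc => ?_
    rw [Finset.mem_Icc, ← hD.next] at hc
    exact hx _ hc
  have e4 : Finset.Icc (a - 1) b = insert (a - 1) (insert b (Finset.Icc a (b - 1))) := by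
    ext c
    simp only [Finset.mem_Icc, Finset.mem_insert]
    omega
  have hlo : ∑ c ∈ Finset.Icc a b, lo i b x c =
      x (i + 1, b) + ∑ c ∈ Finset.Icc a (b - 1), max (x (i - 1, c + 1)) (x (i + 1, c)) := by
    rw [e1, Finset.sum_insert (by simp)]
    congr 1
    · simp [lo]
    · refine Finset.sum_congr rfl fun c hc => if_pos ?_
      rw [Finset.mem_Icc] at hc
      omega
  have hup : ∑ c ∈ Finset.Icc a b, up i a x c =
      x (i + 1, a - 1) + ∑ c ∈ Finset.Icc a (b - 1), min (x (i - 1, c + 1)) (x (i + 1, c)) := by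
    rw [e2, Finset.sum_insert (by simp), shift]
    congr 1
    · simp [up]
    · refine Finset.sum_congr rfl fun c hc => ?_
      rw [Finset.mem_Icc] at hc
      rw [up, if_pos (by omega), add_sub_cancel_right]
  rw [Finset.sum_add_distrib, hlo, hup, shift, e3, e4,
    Finset.sum_insert (by simp only [Finset.mem_insert, Finset.mem_Icc]; omega),
    Finset.sum_insert (by simp)]
  have hmm : ∑ c ∈ Finset.Icc a (b - 1), max (x (i - 1, c + 1)) (x (i + 1, c)) +
      ∑ c ∈ Finset.Icc a (b - 1), min (x (i - 1, c + 1)) (x (i + 1, c)) =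
      ∑ c ∈ Finset.Icc a (b - 1), x (i - 1, c + 1) + ∑ c ∈ Finset.Icc a (b - 1), x (i + 1, c) := by
    rw [← Finset.sum_add_distrib, ← Finset.sum_add_distrib]
    exact Finset.sum_congr rfl fun c _ => max_add_min _ _
  linarith

/-- The face of the cone on which the unbounded entries at the ends of row `i` attain their only
bound. -/
def endFace (D : Finset (ℤ × ℤ)) (o : ℤ × ℤ) (i a b a' b' : ℤ) : Set (ℤ × ℤ → ℤ) :=
  {x | (x ∈ gtCone D o ∧ (a' = a → x (i, a) = lo i b x a)) ∧ (b' = b - 1 → x (i, b) = up i a x b)}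

theorem IsWideRow.reflectRow_mem_iff (hD : IsWideRow D i a b a' b') (ho : o.1 ≠ i)
    (x : ℤ × ℤ → ℤ) :
    reflectRow i a b x ∈ endFace D o i a b a' b' ↔ x ∈ gtCone (trim D i a b a' b') o := by
  have hl := hD.left
  have hr := hD.right
  have hlt := hD.lt
  have hne : ∀ v : ℤ × ℤ, v.1 ≠ i → reflectRow i a b x v = x v := fun v => reflectRow_of_ne x
  rw [endFace]
  constructor
  · rintro ⟨⟨h, hA⟩, hB⟩
    rw [hD.mem_gtCone_iff subset_rfl fun _ _ => Iff.rfl] at h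
    rw [hD.mem_gtCone_iff trim_subset fun _ h => mem_trim_of_ne h]
    obtain ⟨h1, h2, h3, h4⟩ := h
    have hz : ∀ c, (i + 1, c) ∉ D → x (i + 1, c) = 0 := fun c hc => by
      rw [← hne (i + 1, c) (by simp)]
      exact h1 _ hc
    refine ⟨?_, ?_, fun e he he1 he2 => ?_, fun c hc => ?_⟩
    · rintro ⟨r, c⟩ hu
      by_cases hr : r = i
      · subst hr
        by_cases hc : a ≤ c ∧ c ≤ b
        · rw [hD.mem_trim_row] at hu
          by_cases hca : c = a ∧ a' = a
          · obtain ⟨rfl, hac⟩ := hca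
            have := hA hac
            rw [reflectRow_of_mem _ hc, lo_congr hne] at this
            have h0 : up r c x c = 0 := by
              rw [up, if_neg (lt_irrefl _)]
              refine hz _ ?_
              rw [hD.next]
              omega
            linarith
          · obtain ⟨rfl, hbc⟩ : c = b ∧ b' = b - 1 := by omega
            have := hB hbc
            rw [reflectRow_of_mem _ hc, up_congr hne] at this
            have h0 : lo r c x c = 0 := by
              rw [lo, if_neg (lt_irrefl _)]
              refine hz _ ?_
              rw [hD.next]
              omega
            linarith
        · have := h1 (r, c) (by rwa [hD.row])
          rwa [reflectRow, if_neg (fun h => hc h.2)] at this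
      · rw [← hne (r, c) hr]
        refine h1 _ fun h => hu ?_
        rwa [mem_trim_of_ne (v := (r, c)) hr]
    · rwa [hne o ho] at h2
    · have := h3 e he he1 he2
      rwa [hne _ he1, hne _ he2] at this
    · rw [hD.mem_trim_row] at hc
      have := h4 c ((hD.row c).2 hc.1)
      rw [reflectRow_of_mem _ hc.1, lo_congr hne, up_congr hne] at this
      have h5 := this.1 hc.2.2
      have h6 := this.2 hc.2.1
      constructor <;> intro <;> linarith
  · intro h
    rw [hD.mem_gtCone_iff trim_subset fun _ h => mem_trim_of_ne h] at h
    obtain ⟨h1, h2, h3, h4⟩ := h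
    have hz : ∀ c, (i + 1, c) ∉ D → x (i + 1, c) = 0 := fun c hc =>
      h1 _ fun h => hc (trim_subset h)
    have hA : a' = a → reflectRow i a b x (i, a) = lo i b x a := by
      intro haa
      have h5 : x (i, a) = 0 := h1 _ (by rw [hD.mem_trim_row]; omega)
      have h6 : up i a x a = 0 := by
        rw [up, if_neg (lt_irrefl _)]
        exact hz _ (by rw [hD.next]; omega)
      rw [reflectRow_of_mem _ ⟨le_rfl, hlt.le⟩, h5, h6]
      ring
    have hB : b' = b - 1 → reflectRow i a b x (i, b) = up i a x b := by
      intro hbb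
      have h5 : x (i, b) = 0 := h1 _ (by rw [hD.mem_trim_row]; omega)
      have h6 : lo i b x b = 0 := by
        rw [lo, if_neg (lt_irrefl _)]
        exact hz _ (by rw [hD.next]; omega)
      rw [reflectRow_of_mem _ ⟨hlt.le, le_rfl⟩, h5, h6]
      ring
    refine ⟨⟨?_, fun e => by rw [hA e, lo_congr hne]⟩, fun e => by rw [hB e, up_congr hne]⟩
    rw [hD.mem_gtCone_iff subset_rfl fun _ _ => Iff.rfl]
    refine ⟨?_, ?_, fun e he he1 he2 => ?_, fun c hc => ?_⟩
    · rintro ⟨r, c⟩ hu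
      have h5 := h1 (r, c) fun h => hu (trim_subset h)
      rwa [reflectRow, if_neg]
      rintro ⟨h6, h7⟩
      simp only at h6 h7
      subst h6
      exact hu ((hD.row c).2 h7)
    · rwa [hne o ho]
    · rw [hne _ he1, hne _ he2]
      exact h3 e he he1 he2
    · rw [lo_congr hne, up_congr hne]
      have hc' := (hD.row c).1 hc
      by_cases hct : (i, c) ∈ trim D i a b a' b'
      · have h5 := h4 c hct
        rw [hD.mem_trim_row] at hct
        have h6 := h5.1 hct.2.2
        have h7 := h5.2 hct.2.1
        rw [reflectRow_of_mem _ hc']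
        constructor <;> intro <;> linarith
      · rw [hD.mem_trim_row] at hct
        by_cases hca : c = a ∧ a' = a
        · obtain ⟨rfl, hac⟩ := hca
          rw [hA hac]
          exact ⟨fun _ => le_rfl, fun h => by omega⟩
        · obtain ⟨rfl, hbc⟩ : c = b ∧ b' = b - 1 := by omega
          rw [hB hbc]
          exact ⟨fun h => by omega, fun _ => le_rfl⟩

theorem IsWideRow.rowSum_reflectRow (hD : IsWideRow D i a b a' b') {E : Finset (ℤ × ℤ)}
    (hDE : D ⊆ E) {x : ℤ × ℤ → ℤ} (hx : ∀ u, u ∉ D → x u = 0) :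
    rowSum Prod.fst E (reflectRow i a b x) = reflect i (rowSum Prod.fst E x) := by
  have hx' : ∀ u, u ∉ D → reflectRow i a b x u = 0 := by
    rintro ⟨r, c⟩ hu
    rw [reflectRow, if_neg, hx _ hu]
    rintro ⟨h6, h7⟩
    simp only at h6 h7
    subst h6
    exact hu ((hD.row c).2 h7)
  ext r
  by_cases hr : r = i
  · subst hr
    rw [reflect_apply_self, rowSum_eq_sum_Icc hDE hx' hD.row, rowSum_eq_sum_Icc hDE hx hD.row,
      rowSum_eq_sum_Icc hDE hx hD.prev, rowSum_eq_sum_Icc hDE hx hD.next,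
      ← hD.sum_lo_add_up hx, ← Finset.sum_sub_distrib]
    refine Finset.sum_congr rfl fun c hc => ?_
    rw [Finset.mem_Icc] at hc
    exact reflectRow_of_mem x hc
  · rw [reflect_apply_of_ne hr, rowSum_apply, rowSum_apply]
    refine Finset.sum_congr rfl fun v _ => ?_
    split_ifs with hv
    · exact reflectRow_of_ne x (by rwa [hv])
    · rfl

/-- The homomorphism that forgets the entries of row `i`. -/
def eraseRow (i : ℤ) : (ℤ × ℤ → ℤ) →+ (ℤ × ℤ → ℤ) where
  toFun x v := if v.1 = i then 0 else x v
  map_zero' := by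
    funext v
    simp
  map_add' x y := by
    funext v
    by_cases h : v.1 = i <;> simp [h]

theorem eraseRow_of_ne {i : ℤ} (x : ℤ × ℤ → ℤ) {v : ℤ × ℤ} (h : v.1 ≠ i) :
    eraseRow i x v = x v :=
  if_neg h

theorem eraseRow_reflectRow (i a b : ℤ) (x : ℤ × ℤ → ℤ) :
    eraseRow i (reflectRow i a b x) = eraseRow i x := by
  funext v
  by_cases h : v.1 = i
  · exact (if_pos h).trans (if_pos h).symm
  · rw [eraseRow_of_ne _ h, eraseRow_of_ne _ h, reflectRow_of_ne _ h]

variable {K : Type*} [Field K]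

/-- After trimming, all entries of row `i` are bounded on both sides by the other rows. -/
theorem IsWideRow.fiberFinite (hD : IsWideRow D i a b a' b')
    (χ : Multiplicative (ℤ × ℤ → ℤ) →* K) :
    FiberFinite (eraseRow i) (wInd χ (gtCone (trim D i a b a' b') o)) := by
  intro h
  refine Set.Finite.subset (s := {x | eraseRow i x = h ∧ x ∈ gtCone (trim D i a b a' b') o}) ?_ ?_
  · refine Set.Finite.of_injOn (f := fun x (c : Finset.Icc a b) => x (i, c.1))
      (t := Set.Icc (fun c => min 0 (lo i b h c.1)) (fun c => max 0 (up i a h c.1))) ?_ ?_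
      (Set.finite_Icc _ _)
    · rintro x ⟨hxh, hx⟩
      have hne : ∀ v : ℤ × ℤ, v.1 ≠ i → h v = x v := fun v hv => by
        rw [← hxh, eraseRow_of_ne _ hv]
      rw [hD.mem_gtCone_iff trim_subset fun _ h => mem_trim_of_ne h] at hx
      refine Set.mem_Icc.2 (forall_and.1 fun c => ?_)
      simp only [lo_congr hne, up_congr hne]
      by_cases hc : (i, c.1) ∈ trim D i a b a' b'
      · have h1 := hx.2.2.2 _ hc
        rw [hD.mem_trim_row] at hc
        exact ⟨(min_le_right _ _).trans (h1.1 hc.2.2), (h1.2 hc.2.1).trans (le_max_right _ _)⟩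
      · rw [hx.1 _ hc]
        exact ⟨min_le_left _ _, le_max_left _ _⟩
    · rintro x ⟨hxh, hx⟩ y ⟨hyh, hy⟩ hxy
      funext v
      by_cases hv : v.1 = i
      · obtain ⟨r, c⟩ := v
        simp only at hv
        subst hv
        by_cases hc : a ≤ c ∧ c ≤ b
        · exact congrFun hxy ⟨c, Finset.mem_Icc.2 hc⟩
        · have hc' : (r, c) ∉ trim D r a b a' b' := fun h => hc ((hD.row c).1 (trim_subset h))
          rw [hx.1 _ hc', hy.1 _ hc']
      · rw [← eraseRow_of_ne x hv, ← eraseRow_of_ne y hv, hxh, hyh]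
  · intro x hx
    rw [Set.support_indicator] at hx
    refine ⟨hx.1, ?_⟩
    by_contra hx'
    exact hx.2 (wInd_of_notMem χ hx')

/-- Changing an entry of row `i` within its bounds does not leave the cone. -/
theorem IsWideRow.mem_gtCone_of_eq_off (hD : IsWideRow D i a b a' b') (ho : o.1 ≠ i) {c : ℤ}
    (hc : (i, c) ∈ D) {x y : ℤ × ℤ → ℤ} (hx : x ∈ gtCone D o) (hxy : ∀ v, v ≠ (i, c) → x v = y v)
    (hlo : (c < b ∨ b' = b) → lo i b x c ≤ y (i, c))
    (hup : (a < c ∨ a' = a - 1) → y (i, c) ≤ up i a x c) : y ∈ gtCone D o := by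
  rw [hD.mem_gtCone_iff subset_rfl fun _ _ => Iff.rfl] at hx ⊢
  have hne : ∀ v : ℤ × ℤ, v.1 ≠ i → y v = x v := fun v hv =>
    (hxy v fun h => hv (by rw [h])).symm
  obtain ⟨h1, h2, h3, h4⟩ := hx
  refine ⟨fun u hu => ?_, ?_, fun e he he1 he2 => ?_, fun c₁ hc₁ => ?_⟩
  · rw [← hxy u fun h => hu (h ▸ hc)]
    exact h1 u hu
  · rwa [hne o ho]
  · rw [hne _ he1, hne _ he2]
    exact h3 e he he1 he2
  · rw [lo_congr hne, up_congr hne]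
    by_cases hcc : c₁ = c
    · subst hcc
      exact ⟨hlo, hup⟩
    · rw [← hxy (i, c₁) fun h => hcc (congrArg Prod.snd h)]
      exact h4 c₁ hc₁

/-- If the leftmost entry of row `i` is unbounded above, the difference of the cone and its
translate is the face on which this entry attains its lower bound. -/
theorem IsWideRow.peel_left (hD : IsWideRow D i a b a' b') (ho : o.1 ≠ i) (ha : a' = a) :
    (∀ x, x - ind {(i, a)} ∈ gtCone D o → x ∈ gtCone D o) ∧
    ∀ x, (x ∈ gtCone D o ∧ (a' = a → x (i, a) = lo i b x a)) ↔
      x ∈ gtCone D o ∧ x - ind {(i, a)} ∉ gtCone D o := by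
  have hlt := hD.lt
  have hmem : (i, a) ∈ D := (hD.row a).2 ⟨le_rfl, hlt.le⟩
  have hval : ∀ x : ℤ × ℤ → ℤ, (x - ind {(i, a)}) (i, a) = x (i, a) - 1 := by simp [ind]
  have hoff : ∀ (x : ℤ × ℤ → ℤ) (v), v ≠ (i, a) → (x - ind {(i, a)}) v = x v := by
    intro x v hv
    simp [ind, hv]
  have hbd : ∀ x ∈ gtCone D o, lo i b x a ≤ x (i, a) := fun x hx =>
    (((hD.mem_gtCone_iff subset_rfl fun _ _ => Iff.rfl).1 hx).2.2.2 a hmem).1 (.inl hlt)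
  have hcongr : ∀ x : ℤ × ℤ → ℤ, lo i b (x - ind {(i, a)}) a = lo i b x a := fun x =>
    lo_congr (fun v hv => hoff x v fun h => hv (by rw [h])) a
  refine ⟨fun x hx => ?_, fun x => and_congr_right fun hx => ⟨fun h hx' => ?_, fun h _ => ?_⟩⟩
  · refine hD.mem_gtCone_of_eq_off ho hmem hx (hoff x) (fun _ => ?_) fun h => by omega
    have := hbd _ hx
    rw [hval] at this
    linarith
  · have h1 := hbd _ hx'
    rw [hval, hcongr, h ha] at h1
    omega
  · by_contra hne
    refine h (hD.mem_gtCone_of_eq_off ho hmem hx (fun v hv => (hoff x v hv).symm) (fun _ => ?_)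
      fun h => by omega)
    have := hbd x hx
    rw [hval]
    omega

/-- If the rightmost entry of row `i` is unbounded below, the difference of the face and its
translate is the smaller face on which this entry attains its upper bound. -/
theorem IsWideRow.peel_right (hD : IsWideRow D i a b a' b') (ho : o.1 ≠ i) (hb : b' = b - 1)
    {P : Set (ℤ × ℤ → ℤ)}
    (hP : ∀ x, x ∈ P ↔ x ∈ gtCone D o ∧ (a' = a → x (i, a) = lo i b x a)) :
    (∀ x, x - -ind {(i, b)} ∈ P → x ∈ P) ∧
    ∀ x, x ∈ endFace D o i a b a' b' ↔ x ∈ P ∧ x - -ind {(i, b)} ∉ P := by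
  have hlt := hD.lt
  have hmem : (i, b) ∈ D := (hD.row b).2 ⟨hlt.le, le_rfl⟩
  have hval : ∀ x : ℤ × ℤ → ℤ, (x - -ind {(i, b)}) (i, b) = x (i, b) + 1 := by simp [ind]
  have hoff : ∀ (x : ℤ × ℤ → ℤ) (v), v ≠ (i, b) → (x - -ind {(i, b)}) v = x v := by
    intro x v hv
    simp [ind, hv]
  have hbd : ∀ x ∈ gtCone D o, x (i, b) ≤ up i a x b := fun x hx =>
    (((hD.mem_gtCone_iff subset_rfl fun _ _ => Iff.rfl).1 hx).2.2.2 b hmem).2 (.inl hlt)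
  have hcongr : ∀ x : ℤ × ℤ → ℤ, up i a (x - -ind {(i, b)}) b = up i a x b := fun x =>
    up_congr (fun v hv => hoff x v fun h => hv (by rw [h])) b
  have hleft : ∀ x : ℤ × ℤ → ℤ, (x - -ind {(i, b)}) (i, a) = x (i, a) ∧
      lo i b (x - -ind {(i, b)}) a = lo i b x a := fun x =>
    ⟨hoff x _ fun h => hlt.ne (congrArg Prod.snd h),
      lo_congr (fun v hv => hoff x v fun h => hv (by rw [h])) a⟩
  refine ⟨fun x hx => ?_, fun x => ?_⟩
  · rw [hP] at hx ⊢
    rw [(hleft x).1, (hleft x).2] at hx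
    refine ⟨hD.mem_gtCone_of_eq_off ho hmem hx.1 (hoff x) (fun h => by omega) fun _ => ?_, hx.2⟩
    have := hbd _ hx.1
    rw [hval] at this
    linarith
  · rw [endFace, Set.mem_ofPred_eq, ← hP]
    refine and_congr_right fun hx => ?_
    rw [hP] at hx
    rw [hP, (hleft x).1, (hleft x).2]
    refine ⟨fun h hx' => ?_, fun h _ => ?_⟩
    · have h1 := hbd _ hx'.1
      rw [hval, hcongr, h hb] at h1
      omega
    · by_contra hne
      refine h ⟨hD.mem_gtCone_of_eq_off ho hmem hx.1 (fun v hv => (hoff x v hv).symm)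
        (fun h => by omega) fun _ => ?_, hx.2⟩
      have := hbd x hx.1
      rw [hval]
      omega

/-- Reflecting row `i` replaces `D` by its trimmed version and twists the weight by the reflection
of row sums. -/
theorem IsWideRow.regZero_of_trim (hD : IsWideRow D i a b a' b') {E : Finset (ℤ × ℤ)}
    (hDE : D ⊆ E) (hoD : o ∈ D) (ho : o.1 ≠ i) {ψ : Multiplicative (ℤ →₀ ℤ) →* K}
    (hψ : Function.Injective ψ)
    (h : RegZero (wInd (rowWeight Prod.fst E (ψ.comp (AddMonoidHom.toMultiplicative (reflect i))))
      (gtCone (trim D i a b a' b') o))) :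
    RegZero (wInd (rowWeight Prod.fst E ψ) (gtCone D o)) := by
  classical
  have hlt := hD.lt
  have hl := hD.left
  have hr := hD.right
  set χ := rowWeight Prod.fst E ψ with hχ
  have hA : χ (.ofAdd (ind {(i, a)})) ≠ 1 := by
    exact rowWeight_ind_ne_one hψ
      (by simpa using hDE ((hD.row a).2 ⟨le_rfl, hlt.le⟩)) (Set.singleton_nonempty _)
  have hB : χ (.ofAdd (-ind {(i, b)})) ≠ 1 := by
    refine rowWeight_ne_one hψ ?_
    rw [map_neg]
    exact neg_ne_zero.2 (rowSum_ind_ne_zero _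
      (by simpa using hDE ((hD.row b).2 ⟨hlt.le, le_rfl⟩)) (Set.singleton_nonempty _))
  set P : Set (ℤ × ℤ → ℤ) := {x | x ∈ gtCone D o ∧ (a' = a → x (i, a) = lo i b x a)} with hPdef
  have hP : ∀ x, x ∈ P ↔ x ∈ gtCone D o ∧ (a' = a → x (i, a) = lo i b x a) := fun x => Iff.rfl
  have hregD : Reg (wInd χ (gtCone D o)) := reg_orderCone hψ hDE hoD (gtRel_subset D)
  have hregP : Reg (wInd χ P) ∧ (RegZero (wInd χ P) → RegZero (wInd χ (gtCone D o))) := by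
    by_cases ha : a' = a
    · obtain ⟨h1, h2⟩ := hD.peel_left ho ha
      exact ⟨hregD.peel _ h1 h2, RegZero.of_peel _ hA h1 h2⟩
    · have : P = gtCone D o := Set.ext fun x => by simp [hP, ha]
      rw [this]
      exact ⟨hregD, id⟩
  have hregF : Reg (wInd χ (endFace D o i a b a' b')) ∧
      (RegZero (wInd χ (endFace D o i a b a' b')) → RegZero (wInd χ P)) := by
    by_cases hb : b' = b - 1
    · obtain ⟨h1, h2⟩ := hD.peel_right ho hb hP
      exact ⟨hregP.1.peel _ h1 h2, RegZero.of_peel _ hB h1 h2⟩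
    · have : endFace D o i a b a' b' = P := Set.ext fun x => by simp [hP, hb, endFace]
      rw [this]
      exact ⟨hregP.1, id⟩
  refine hregP.2 (hregF.2 ?_)
  -- On the face, the reflection of row `i` fixes the other rows and maps onto the trimmed cone.
  refine RegZero.of_fiberwise_equiv (π := eraseRow i) (reflectRow_involutive i a b).toPerm
    (eraseRow_reflectRow i a b) (fun x => ?_) (hD.fiberFinite _) hregF.1 h
  have hmem := hD.reflectRow_mem_iff ho x
  by_cases hx : x ∈ gtCone (trim D i a b a' b') o
  · rw [wInd_of_mem _ hx]
    refine (wInd_of_mem χ (hmem.2 hx)).trans ?_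
    rw [hχ, rowWeight_apply, rowWeight_apply,
      hD.rowSum_reflectRow hDE fun u hu => hx.1 u fun h => hu (trim_subset h)]
    rfl
  · rw [wInd_of_notMem _ hx]
    exact wInd_of_notMem χ fun h => hx (hmem.1 h)

end Toggle

/-! ### Shapes with a wide row -/

/-- `D` consists of the nodes in rows `r₀, …, r₁` with columns from `a r` to `b r` in row `r`. Both
ends of a row move by half a step to the left or to the right from each row to the next, the first
and the last row have a single node, and some row has several. -/
structure IsShape (D : Finset (ℤ × ℤ)) (r₀ r₁ : ℤ) (a b : ℤ → ℤ) : Prop where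
  mem : ∀ r c, (r, c) ∈ D ↔ (r₀ ≤ r ∧ r ≤ r₁) ∧ a r ≤ c ∧ c ≤ b r
  le : ∀ r, r₀ ≤ r → r ≤ r₁ → a r ≤ b r
  left : ∀ r, r₀ ≤ r → r < r₁ → a (r + 1) = a r ∨ a (r + 1) = a r - 1
  right : ∀ r, r₀ ≤ r → r < r₁ → b (r + 1) = b r ∨ b (r + 1) = b r - 1
  first : a r₀ = b r₀
  last : a r₁ = b r₁
  wide : ∃ r, r₀ ≤ r ∧ r ≤ r₁ ∧ a r < b r

/-- The first row of maximal width can be reflected, and the next row is not wider. -/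
theorem IsShape.exists_isWideRow {D : Finset (ℤ × ℤ)} {r₀ r₁ : ℤ} {a b : ℤ → ℤ}
    (h : IsShape D r₀ r₁ a b) : ∃ i, r₀ < i ∧ i < r₁ ∧
      IsWideRow D i (a i) (b i) (a (i + 1)) (b (i + 1)) ∧
      (a (i + 1) = a i ∨ b (i + 1) = b i - 1) ∧ a (i - 1) = a i + 1 ∧ b (i - 1) = b i := by
  obtain ⟨r, hr0, hr1, hrw⟩ := h.wide
  obtain ⟨m, hm, hmax⟩ := Finset.exists_max_image (Finset.Icc r₀ r₁) (fun r => b r - a r)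
    ⟨r, Finset.mem_Icc.2 ⟨hr0, hr1⟩⟩
  obtain ⟨i, hi, hmin⟩ := Finset.exists_min_image
    ((Finset.Icc r₀ r₁).filter fun r => b r - a r = b m - a m) id
    ⟨m, Finset.mem_filter.2 ⟨hm, rfl⟩⟩
  obtain ⟨hi, him⟩ := Finset.mem_filter.1 hi
  rw [Finset.mem_Icc] at hi
  have hwr := hmax r (Finset.mem_Icc.2 ⟨hr0, hr1⟩)
  have hi0 : r₀ < i := by
    refine lt_of_le_of_ne hi.1 ?_
    rintro rfl
    have := h.first
    omega
  have hi1 : i < r₁ := by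
    refine lt_of_le_of_ne hi.2 ?_
    rintro rfl
    have := h.last
    omega
  have h1 := hmax (i + 1) (Finset.mem_Icc.2 ⟨by omega, by omega⟩)
  have h2 := hmax (i - 1) (Finset.mem_Icc.2 ⟨by omega, by omega⟩)
  have h3 : b (i - 1) - a (i - 1) ≠ b m - a m := by
    intro h3
    have := hmin (i - 1) (Finset.mem_filter.2 ⟨Finset.mem_Icc.2 ⟨by omega, by omega⟩, h3⟩)
    simp only [id] at this
    omega
  have h4 := h.left (i - 1) (by omega) (by omega)
  have h5 := h.right (i - 1) (by omega) (by omega)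
  have h6 := h.left i (by omega) (by omega)
  have h7 := h.right i (by omega) (by omega)
  rw [sub_add_cancel] at h4 h5
  refine ⟨i, hi0, hi1, ⟨fun c => ?_, fun c => ?_, fun c => ?_, ?_, h6, h7⟩, ?_, ?_, ?_⟩
  · rw [h.mem]
    omega
  · rw [h.mem]
    omega
  · rw [h.mem]
    omega
  all_goals omega

/-- Order cones are invariant under translations that respect the defining inequalities. -/
theorem sub_mem_orderCone_iff {ι : Type*} {D : Finset ι} {o : ι} {R : Finset (ι × ι)} {v : ι → ℤ}
    (hvD : ∀ u, u ∉ D → v u = 0) (hvo : v o = 0) (hvR : ∀ e ∈ R, v e.1 = v e.2) (x : ι → ℤ) :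
    x - v ∈ orderCone D o R ↔ x ∈ orderCone D o R := by
  rw [mem_orderCone, mem_orderCone, Pi.sub_apply, hvo, sub_zero]
  refine and_congr (forall₂_congr fun u hu => ?_) (and_congr_right fun _ => forall₂_congr
    fun e he => ?_)
  · rw [Pi.sub_apply, hvD u hu, sub_zero]
  · rw [Pi.sub_apply, Pi.sub_apply, hvR e he, sub_le_sub_iff_right]

/-- The regularized sum vanishes if an empty row separates some nodes of `D` from the node whose
entry is fixed: these nodes can be translated together. -/
theorem regZero_of_empty_row {K : Type*} [Field K] {D E : Finset (ℤ × ℤ)} (hDE : D ⊆ E)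
    {o : ℤ × ℤ} {i : ℤ} (ho : o.1 < i) (hi : ∀ c, (i, c) ∉ D) {c : ℤ} (hc : (i + 1, c) ∈ D)
    {ψ : Multiplicative (ℤ →₀ ℤ) →* K} (hψ : Function.Injective ψ) :
    RegZero (wInd (rowWeight Prod.fst E ψ) (gtCone D o)) := by
  refine RegZero.of_translate (ind {v | v ∈ D ∧ i < v.1})
    (rowWeight_ind_ne_one hψ (fun v hv => hDE hv.1) ⟨(i + 1, c), hc, by simp⟩)
    (sub_mem_orderCone_iff (fun u hu => ?_) ?_ fun e he => ?_)
  · simp [ind, hu]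
  · simp [ind, ho.not_gt]
  · obtain ⟨⟨h1, h2⟩, h3⟩ := mem_gtRel.1 he
    have h4 : e.1.1 ≠ i := fun h => hi e.1.2 (by rw [← h]; exact h1)
    have h5 : e.2.1 ≠ i := fun h => hi e.2.2 (by rw [← h]; exact h2)
    have h6 : i < e.1.1 ↔ i < e.2.1 := by
      rcases h3 with h3 | h3 <;> rw [h3] at h5 ⊢ <;> simp only at h5 ⊢ <;> omega
    simp [ind, h1, h2, h6]

/-- Trimming the first row of maximal width yields a shape again, unless the row disappears. -/
theorem IsShape.trim {D : Finset (ℤ × ℤ)} {r₀ r₁ : ℤ} {a b : ℤ → ℤ} (h : IsShape D r₀ r₁ a b)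
    {i : ℤ} (hi0 : r₀ < i) (hi1 : i < r₁) (hD : IsWideRow D i (a i) (b i) (a (i + 1)) (b (i + 1)))
    (ha : a (i - 1) = a i + 1) (hb : b (i - 1) = b i)
    (hne : ¬(a (i + 1) = a i ∧ b (i + 1) = b i - 1 ∧ b i = a i + 1)) :
    IsShape (trim D i (a i) (b i) (a (i + 1)) (b (i + 1))) r₀ r₁
      (fun r => if r = i then a (i + 1) + 1 else a r)
      (fun r => if r = i then b (i + 1) else b r) := by
  have hlt := hD.lt
  have hl := hD.left
  have hr := hD.right
  refine ⟨fun r c => ?_, fun r hr0 hr1 => ?_, fun r hr0 hr1 => ?_, fun r hr0 hr1 => ?_, ?_, ?_, ?_⟩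
  · by_cases hri : r = i
    · subst hri
      rw [hD.mem_trim_row, if_pos rfl, if_pos rfl]
      omega
    · rw [mem_trim_of_ne (by exact hri), h.mem, if_neg hri, if_neg hri]
  · have := h.le r hr0 hr1
    split_ifs <;> omega
  · have := h.left r hr0 hr1
    by_cases hri : r = i
    · subst hri
      rw [if_pos rfl, if_neg (by omega)]
      omega
    · by_cases hri' : r + 1 = i
      · obtain rfl : r = i - 1 := by omega
        rw [if_pos hri', if_neg hri]
        omega
      · rw [if_neg hri, if_neg hri']
        exact this
  · have := h.right r hr0 hr1
    by_cases hri : r = i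
    · subst hri
      rw [if_pos rfl, if_neg (by omega)]
      omega
    · by_cases hri' : r + 1 = i
      · obtain rfl : r = i - 1 := by omega
        rw [if_pos hri', if_neg hri]
        omega
      · rw [if_neg hri, if_neg hri']
        exact this
  · rw [if_neg hi0.ne, if_neg hi0.ne]
    exact h.first
  · rw [if_neg hi1.ne', if_neg hi1.ne']
    exact h.last
  · by_cases hbb : b i = a i + 1
    · refine ⟨i + 1, by omega, by omega, ?_⟩
      rw [if_neg (by omega), if_neg (by omega)]
      omega
    · refine ⟨i - 1, by omega, by omega, ?_⟩
      rw [if_neg (by omega), if_neg (by omega)]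
      omega

/-- The weighted cone of a shape with a wide row has regularized sum zero. Each reflection removes
nodes, until some row disappears. -/
theorem IsShape.regZero {K : Type*} [Field K] {E D : Finset (ℤ × ℤ)} {r₀ r₁ : ℤ} {a b : ℤ → ℤ}
    (h : IsShape D r₀ r₁ a b) (hDE : D ⊆ E) {o : ℤ × ℤ} (hoD : o ∈ D) (ho : o.1 = r₀)
    {ψ : Multiplicative (ℤ →₀ ℤ) →* K} (hψ : Function.Injective ψ) :
    RegZero (wInd (rowWeight Prod.fst E ψ) (gtCone D o)) := by
  induction hn : D.card using Nat.strong_induction_on generalizing D a b ψ with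
  | _ n ih =>
  subst hn
  obtain ⟨i, hi0, hi1, hD, hout, ha, hb⟩ := h.exists_isWideRow
  have hlt := hD.lt
  have hψ' := injective_comp_reflect hψ i
  have hoi : o.1 ≠ i := by omega
  refine hD.regZero_of_trim hDE hoD hoi hψ ?_
  by_cases hne : a (i + 1) = a i ∧ b (i + 1) = b i - 1 ∧ b i = a i + 1
  · -- Row `i` had two nodes, and loses both.
    refine regZero_of_empty_row (trim_subset.trans hDE) (i := i) (by omega) (fun c => ?_)
      (c := a (i + 1)) ?_ hψ'
    · rw [hD.mem_trim_row]
      omega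
    · rw [mem_trim_of_ne (by simp), hD.next]
      omega
  · refine ih _ (Finset.card_lt_card ?_) (h.trim hi0 hi1 hD ha hb hne)
      (trim_subset.trans hDE) ((mem_trim_of_ne hoi).2 hoD) hψ' rfl
    refine ⟨trim_subset, fun hsub => ?_⟩
    rcases hout with hout | hout
    · have := hsub ((hD.row (a i)).2 ⟨le_rfl, hlt.le⟩)
      rw [hD.mem_trim_row] at this
      omega
    · have := hsub ((hD.row (b i)).2 ⟨hlt.le, le_rfl⟩)
      rw [hD.mem_trim_row] at this
      omega

/-! ### Connected sets of nodes with property A -/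

/-- `u` and `w` are adjacent positions of consecutive rows. -/
def Near (u w : ℤ × ℤ) : Prop :=
  (w.1 = u.1 + 1 ∧ (w.2 = u.2 ∨ w.2 = u.2 - 1)) ∨ (u.1 = w.1 + 1 ∧ (u.2 = w.2 ∨ u.2 = w.2 - 1))

/-- The values `p 0, …, p l` form a walk in `D`. -/
def IsPath (D : Finset (ℤ × ℤ)) (p : ℕ → ℤ × ℤ) (l : ℕ) : Prop :=
  (∀ t ≤ l, p t ∈ D) ∧ ∀ t < l, Near (p t) (p (t + 1))

/-- Two horizontally neighboring nodes are accompanied by their common neighbors above and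
below. -/
def HasDiamonds (D : Finset (ℤ × ℤ)) : Prop :=
  ∀ r c, (r, c) ∈ D → (r, c + 1) ∈ D → (r - 1, c + 1) ∈ D ∧ (r + 1, c) ∈ D

theorem IsPath.take {D : Finset (ℤ × ℤ)} {p : ℕ → ℤ × ℤ} {l : ℕ} (h : IsPath D p l) {m : ℕ}
    (hm : m ≤ l) : IsPath D p m :=
  ⟨fun t ht => h.1 t (by omega), fun t ht => h.2 t (by omega)⟩

theorem IsPath.shift {D : Finset (ℤ × ℤ)} {p : ℕ → ℤ × ℤ} {l : ℕ} (h : IsPath D p l) {s m : ℕ}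
    (hm : s + m ≤ l) : IsPath D (fun t => p (s + t)) m :=
  ⟨fun t ht => h.1 (s + t) (by omega), fun t ht => h.2 (s + t) (by omega)⟩

/-- If two nodes of a row are joined by a walk in `D`, all nodes between them belong to `D`. A walk
that returns to the row midway is split there. Otherwise its second and its last but one node lie in
the same neighboring row, the nodes between these belong to `D` by induction, and property A leads
back to the row. -/
theorem IsPath.row_convex {D : Finset (ℤ × ℤ)} (hA : HasDiamonds D) {l : ℕ} {p : ℕ → ℤ × ℤ}
    (hp : IsPath D p l) {i : ℤ} (h0 : (p 0).1 = i) (hl : (p l).1 = i) {c : ℤ}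
    (hc : min (p 0).2 (p l).2 ≤ c) (hc' : c ≤ max (p 0).2 (p l).2) : (i, c) ∈ D := by
  induction l using Nat.strong_induction_on generalizing p i c with
  | _ l ih =>
  have hm0 : (i, (p 0).2) ∈ D := h0 ▸ hp.1 0 (Nat.zero_le _)
  have hml : (i, (p l).2) ∈ D := hl ▸ hp.1 l le_rfl
  by_cases hsplit : ∃ t, 0 < t ∧ t < l ∧ (p t).1 = i
  · obtain ⟨t, ht0, htl, ht⟩ := hsplit
    by_cases h1 : min (p 0).2 (p t).2 ≤ c ∧ c ≤ max (p 0).2 (p t).2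
    · exact ih t htl (hp.take htl.le) h0 ht h1.1 h1.2
    · have e : t + (l - t) = l := by omega
      refine ih (l - t) (by omega) (hp.shift (s := t) (by omega)) ht ?_ ?_ ?_
      · simpa only [e] using hl
      · simp only [e, add_zero]
        omega
      · simp only [e, add_zero]
        omega
  push Not at hsplit
  by_cases hce : c = (p 0).2 ∨ c = (p l).2
  · rcases hce with rfl | rfl
    · exact hm0
    · exact hml
  have hl0 : l ≠ 0 := by
    rintro rfl
    omega
  have hl1 : l ≠ 1 := by
    rintro rfl
    have := hp.2 0 one_pos
    unfold Near at this
    rw [zero_add] at this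
    omega
  have e : l - 1 + 1 = l := by omega
  have e' : 1 + (l - 2) = l - 1 := by omega
  have hfirst := hp.2 0 (by omega)
  have hlast := hp.2 (l - 1) (by omega)
  rw [e] at hlast
  rw [zero_add] at hfirst
  have hshift : IsPath D (fun t => p (1 + t)) (l - 2) := hp.shift (by omega)
  have hne := hsplit (l - 1) (by omega) (by omega)
  unfold Near at hfirst hlast
  rcases lt_or_gt_of_ne (hsplit 1 one_pos (by omega)) with h1 | h1
  · -- The interior of the walk stays above the row.
    have hside : ∀ t, t + 1 < l → (p (t + 1)).1 < i := by
      intro t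
      induction t with
      | zero => exact fun _ => h1
      | succ t iht =>
        intro ht
        have h2 := iht (by omega)
        have h3 := hp.2 (t + 1) (by omega)
        have h4 := hsplit (t + 1 + 1) (by omega) ht
        unfold Near at h3
        omega
    have h2 := hside (l - 2) (by omega)
    rw [show l - 2 + 1 = l - 1 by omega] at h2
    have key : ∀ d, min (p 1).2 (p (l - 1)).2 ≤ d → d ≤ max (p 1).2 (p (l - 1)).2 →
        (i - 1, d) ∈ D := by
      intro d hd hd'
      refine ih (l - 2) (by omega) hshift ?_ ?_ ?_ ?_
      · simp only [add_zero]
        omega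
      · simp only [e']
        omega
      · simpa only [e', add_zero] using hd
      · simpa only [e', add_zero] using hd'
    have h3 := (hA (i - 1) c (key c (by omega) (by omega)) (key (c + 1) (by omega) (by omega))).2
    rwa [sub_add_cancel] at h3
  · -- The interior of the walk stays below the row.
    have hside : ∀ t, t + 1 < l → i < (p (t + 1)).1 := by
      intro t
      induction t with
      | zero => exact fun _ => h1
      | succ t iht =>
        intro ht
        have h2 := iht (by omega)
        have h3 := hp.2 (t + 1) (by omega)
        have h4 := hsplit (t + 1 + 1) (by omega) ht
        unfold Near at h3
        omega
    have h2 := hside (l - 2) (by omega)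
    rw [show l - 2 + 1 = l - 1 by omega] at h2
    have key : ∀ d, min (p 1).2 (p (l - 1)).2 ≤ d → d ≤ max (p 1).2 (p (l - 1)).2 →
        (i + 1, d) ∈ D := by
      intro d hd hd'
      refine ih (l - 2) (by omega) hshift ?_ ?_ ?_ ?_
      · simp only [add_zero]
        omega
      · simp only [e']
        omega
      · simpa only [e', add_zero] using hd
      · simpa only [e', add_zero] using hd'
    have h3 := (hA (i + 1) (c - 1) (key (c - 1) (by omega) (by omega))
      (by rw [sub_add_cancel]; exact key c (by omega) (by omega))).1
    rwa [sub_add_cancel, add_sub_cancel_right] at h3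

theorem IsPath.exists_crossing {D : Finset (ℤ × ℤ)} {p : ℕ → ℤ × ℤ} {l : ℕ} (hp : IsPath D p l)
    {r : ℤ} (h0 : (p 0).1 ≤ r) (hl : r < (p l).1) :
    ∃ c c', (r, c) ∈ D ∧ (r + 1, c') ∈ D ∧ (c' = c ∨ c' = c - 1) := by
  by_contra hno
  push Not at hno
  have key : ∀ t ≤ l, (p t).1 ≤ r := by
    intro t
    induction t with
    | zero => exact fun _ => h0
    | succ t iht =>
      intro ht
      have h1 := iht (by omega)
      by_contra h2
      have h3 := hp.2 t (by omega)
      unfold Near at h3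
      have h4 : (p t).1 = r := by omega
      have h5 : (p (t + 1)).1 = r + 1 := by omega
      have h6 := hno (p t).2 (p (t + 1)).2 (h4 ▸ hp.1 t (by omega)) (h5 ▸ hp.1 (t + 1) ht)
      omega
  have := key l le_rfl
  omega

/-- A connected set of nodes with property A that has two nodes in some row is a shape. -/
theorem exists_isShape {D : Finset (ℤ × ℤ)} (hA : HasDiamonds D)
    (hconn : ∀ u ∈ D, ∀ w ∈ D, ∃ p l, IsPath D p l ∧ p 0 = u ∧ p l = w)
    {r c c' : ℤ} (hcc : c < c') (hc : (r, c) ∈ D) (hc' : (r, c') ∈ D) :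
    ∃ r₀ r₁ a b, IsShape D r₀ r₁ a b := by
  obtain ⟨u₀, hu₀, hmin⟩ := Finset.exists_min_image D Prod.fst ⟨_, hc⟩
  obtain ⟨u₁, hu₁, hmax⟩ := Finset.exists_max_image D Prod.fst ⟨_, hc⟩
  have hedge : ∀ r, u₀.1 ≤ r → r < u₁.1 →
      ∃ c c', (r, c) ∈ D ∧ (r + 1, c') ∈ D ∧ (c' = c ∨ c' = c - 1) := by
    intro r h0 h1
    obtain ⟨p, l, hp, hp0, hpl⟩ := hconn u₀ hu₀ u₁ hu₁
    exact hp.exists_crossing (by rwa [hp0]) (by rwa [hpl])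
  have hrow : ∀ r, ∃ a b : ℤ, u₀.1 ≤ r → r ≤ u₁.1 →
      a ≤ b ∧ ∀ c, (r, c) ∈ D ↔ a ≤ c ∧ c ≤ b := by
    intro r
    by_cases hr : u₀.1 ≤ r ∧ r ≤ u₁.1
    swap
    · exact ⟨0, 0, fun h0 h1 => absurd ⟨h0, h1⟩ hr⟩
    have hne : ∃ c, (r, c) ∈ D := by
      rcases eq_or_lt_of_le hr.2 with rfl | h1
      · exact ⟨u₁.2, hu₁⟩
      · obtain ⟨c, -, h, -⟩ := hedge r hr.1 h1
        exact ⟨c, h⟩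
    obtain ⟨c₁, hc₁⟩ := hne
    have hne' : (D.filter fun u => u.1 = r).Nonempty := ⟨_, Finset.mem_filter.2 ⟨hc₁, rfl⟩⟩
    obtain ⟨⟨r', a⟩, hma, hamin⟩ := Finset.exists_min_image _ Prod.snd hne'
    obtain ⟨⟨r'', b⟩, hmb, hbmax⟩ := Finset.exists_max_image _ Prod.snd hne'
    obtain rfl : r' = r := (Finset.mem_filter.1 hma).2
    obtain rfl : r'' = r' := (Finset.mem_filter.1 hmb).2
    have ha := (Finset.mem_filter.1 hma).1
    have hb := (Finset.mem_filter.1 hmb).1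
    have hiff : ∀ c, (r'', c) ∈ D ↔ a ≤ c ∧ c ≤ b := by
      refine fun c => ⟨fun h => ?_, fun h => ?_⟩
      · have h' : (r'', c) ∈ D.filter fun u => u.1 = r'' := Finset.mem_filter.2 ⟨h, rfl⟩
        exact ⟨hamin _ h', hbmax _ h'⟩
      · obtain ⟨p, l, hp, hp0, hpl⟩ := hconn _ ha _ hb
        refine hp.row_convex hA (by rw [hp0]) (by rw [hpl]) ?_ ?_ <;>
        · rw [hp0, hpl]
          simp only
          omega
    refine ⟨a, b, fun _ _ => ⟨?_, hiff⟩⟩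
    exact ((hiff a).1 ha).2
  choose a b hab using hrow
  have hstep : ∀ r, u₀.1 ≤ r → r < u₁.1 → (a (r + 1) = a r ∨ a (r + 1) = a r - 1) ∧
      (b (r + 1) = b r ∨ b (r + 1) = b r - 1) := by
    intro r h0 h1
    obtain ⟨hle, h⟩ := hab r h0 h1.le
    obtain ⟨hle', h'⟩ := hab (r + 1) (by omega) (by omega)
    obtain ⟨c₁, c₂, hc₁, hc₂, hcc⟩ := hedge r h0 h1
    rw [h] at hc₁
    rw [h'] at hc₂
    have hdown : ∀ c, a r ≤ c → c + 1 ≤ b r → a (r + 1) ≤ c ∧ c ≤ b (r + 1) := fun c h2 h3 =>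
      (h' c).1 (hA r c ((h c).2 ⟨h2, by omega⟩) ((h (c + 1)).2 ⟨by omega, h3⟩)).2
    have hup : ∀ c, a (r + 1) ≤ c → c + 1 ≤ b (r + 1) → a r ≤ c + 1 ∧ c + 1 ≤ b r := by
      intro c h2 h3
      have := (hA (r + 1) c ((h' c).2 ⟨h2, by omega⟩) ((h' (c + 1)).2 ⟨by omega, h3⟩)).1
      rw [add_sub_cancel_right] at this
      exact (h _).1 this
    have h2 := hdown (a r) le_rfl
    have h3 := hdown (b r - 1)
    have h4 := hup (a (r + 1)) le_rfl
    have h5 := hup (b (r + 1) - 1)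
    omega
  have h01 : u₀.1 ≤ u₁.1 := hmin u₁ hu₁
  refine ⟨u₀.1, u₁.1, a, b, fun r c => ⟨fun h => ?_, fun h => ?_⟩, fun r h0 h1 => (hab r h0 h1).1,
    fun r h0 h1 => (hstep r h0 h1).1, fun r h0 h1 => (hstep r h0 h1).2, ?_, ?_, ?_⟩
  · have h0 : u₀.1 ≤ r := hmin _ h
    have h1 : r ≤ u₁.1 := hmax _ h
    exact ⟨⟨h0, h1⟩, ((hab r h0 h1).2 c).1 h⟩
  · exact ((hab r h.1.1 h.1.2).2 c).2 h.2
  · obtain ⟨hle, h⟩ := hab u₀.1 le_rfl h01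
    by_contra hne
    have := hmin _ (hA _ (a u₀.1) ((h _).2 (by omega)) ((h _).2 (by omega))).1
    simp only at this
    omega
  · obtain ⟨hle, h⟩ := hab u₁.1 h01 le_rfl
    by_contra hne
    have := hmax _ (hA _ (a u₁.1) ((h _).2 (by omega)) ((h _).2 (by omega))).2
    simp only at this
    omega
  · have h0 : u₀.1 ≤ r := hmin _ hc
    have h1 : r ≤ u₁.1 := hmax _ hc
    have h2 := ((hab r h0 h1).2 c).1 hc
    have h3 := ((hab r h0 h1).2 c').1 hc'
    exact ⟨r, h0, h1, by omega⟩

/-! ### Extension by zero and change of coefficients -/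

section Transfer

open AddMonoidAlgebra

/-- Extension by zero along an injective map. -/
noncomputable def extendZero {ι κ : Type*} (e : ι ↪ κ) : (ι → ℤ) →+ (κ → ℤ) where
  toFun x := Function.extend e x 0
  map_zero' := Function.extend_zero e
  map_add' x y := by
    rw [← Function.extend_add, add_zero]

theorem extendZero_apply {ι κ : Type*} (e : ι ↪ κ) (x : ι → ℤ) (u : ι) :
    extendZero e x (e u) = x u :=
  e.injective.extend_apply _ _ _

theorem extendZero_apply_of_notMem {ι κ : Type*} (e : ι ↪ κ) (x : ι → ℤ) {v : κ}
    (hv : ∀ u, e u ≠ v) : extendZero e x v = 0 :=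
  Function.extend_apply' _ _ _ fun ⟨u, hu⟩ => hv u hu

theorem extendZero_injective {ι κ : Type*} (e : ι ↪ κ) : Function.Injective (extendZero e) := by
  intro x y h
  funext u
  rw [← extendZero_apply e x, h, extendZero_apply]

/-- Vanishing of regularized sums can be checked after an injective homomorphism of lattices. -/
theorem RegZero.of_injective {k G H : Type*} [CommRing k] [IsDomain k] [AddCommGroup G]
    [AddCommGroup H] {π : G →+ H} (hπ : Function.Injective π) {χ : Multiplicative G →* k}
    {χ' : Multiplicative H →* k} {P : Set G} {Q : Set H} (hχ : ∀ x, χ' (.ofAdd (π x)) = χ (.ofAdd x))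
    (hPQ : ∀ x, π x ∈ Q ↔ x ∈ P) (hQ : ∀ y ∈ Q, ∃ x, π x = y) (hreg : Reg (wInd χ P))
    (h : RegZero (wInd χ' Q)) : RegZero (wInd χ P) := by
  have hff : FiberFinite π (wInd χ P) := by
    intro y
    refine Set.Subsingleton.finite fun x hx x' hx' => hπ ?_
    rw [Set.support_indicator] at hx hx'
    exact hx.1.trans hx'.1.symm
  refine RegZero.of_push hff hreg ?_
  have e : GTCone.push π (wInd χ P) = wInd χ' Q := by
    funext y
    by_cases hy : ∃ x, π x = y
    · obtain ⟨x, rfl⟩ := hy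
      rw [GTCone.push, finsum_eq_single _ x]
      · rw [Set.indicator_of_mem (by exact rfl)]
        by_cases hx : x ∈ P
        · rw [wInd_of_mem _ hx, wInd_of_mem _ ((hPQ x).2 hx), hχ]
        · rw [wInd_of_notMem _ hx, wInd_of_notMem _ fun h => hx ((hPQ x).1 h)]
      · intro x' hx'
        have hn : x' ∉ π ⁻¹' {π x} := fun h => hx' (hπ h)
        exact Set.indicator_of_notMem hn _
    · rw [wInd_of_notMem _ fun h => hy (hQ y h), GTCone.push]
      refine finsum_eq_zero_of_forall_eq_zero fun x => ?_
      have hn : x ∉ π ⁻¹' {y} := fun h => hy ⟨x, h⟩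
      exact Set.indicator_of_notMem hn _
  rwa [e]

variable {K G : Type*} [Field K] [AddCommGroup G]

/-- The substitution `t ^ a ↦ χ a • t ^ a`, with extension of coefficients from `ℤ` to `K`. -/
noncomputable def twist (χ : Multiplicative G →* K) : AddMonoidAlgebra ℤ G →+ AddMonoidAlgebra K G :=
  liftNC (Int.castAddHom (AddMonoidAlgebra K G)) fun a => single a.toAdd (χ a)

theorem twist_single (χ : Multiplicative G →* K) (a : G) (c : ℤ) :
    twist χ (single a c) = single a (c * χ (.ofAdd a)) := by
  rw [twist, liftNC_single, Int.coe_castAddHom, ← zsmul_eq_mul, smul_single, zsmul_eq_mul]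
  rfl

theorem coeff_twist (χ : Multiplicative G →* K) (p : AddMonoidAlgebra ℤ G) (a : G) :
    (twist χ p).coeff a = χ (.ofAdd a) * (p.coeff a : K) := by
  classical
  induction p using AddMonoidAlgebra.induction_linear with
  | zero => simp
  | add p q hp hq => rw [map_add, coeff_add, Finsupp.add_apply, hp, hq, coeff_add,
      Finsupp.add_apply, Int.cast_add, mul_add]
  | single b c =>
    rw [twist_single, coeff_single, coeff_single, Finsupp.single_apply, Finsupp.single_apply]
    split_ifs with h
    · rw [h, mul_comm]
    · simp

theorem conv_twist (χ : Multiplicative G →* K) (q : AddMonoidAlgebra ℤ G) (f : G → ℤ) (a : G) :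
    conv (twist χ q) (fun x => χ (.ofAdd x) * (f x : K)) a =
      χ (.ofAdd a) * ((conv q f a : ℤ) : K) := by
  induction q using AddMonoidAlgebra.induction_linear with
  | zero => simp [conv_zero_left]
  | add p q hp hq =>
    rw [map_add, conv_add_left, Pi.add_apply, hp, hq, conv_add_left, Pi.add_apply, Int.cast_add,
      mul_add]
  | single b c =>
    rw [twist_single, conv_single, conv_single]
    have hm : χ (.ofAdd b) * χ (.ofAdd (a - b)) = χ (.ofAdd a) := by
      rw [← map_mul, ← ofAdd_add, add_sub_cancel]
    rw [← hm]
    push_cast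
    ring

/-- The numerator of a generating function with regularized sum zero vanishes under the evaluation
`t ^ a ↦ χ a`. -/
theorem RegZero.aug_twist_eq_zero {χ : Multiplicative G →* K} {P : Set G}
    (h : RegZero (wInd χ P)) {q p : AddMonoidAlgebra ℤ G}
    (e : conv q (wInd 1 P) = fun a => p.coeff a) : aug (twist χ p) = 0 := by
  refine h.aug_eq_zero (q := twist χ q) ?_
  have h1 : wInd χ P = fun x => χ (.ofAdd x) * ((wInd 1 P x : ℤ) : K) := by
    funext x
    by_cases hx : x ∈ P
    · rw [wInd_of_mem _ hx, wInd_of_mem _ hx]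
      simp
    · rw [wInd_of_notMem _ hx, wInd_of_notMem _ hx]
      simp
  funext a
  rw [h1, conv_twist, e, coeff_twist]

end Transfer

/-! ### Row sums in the triangle -/

section Triangle

open AddMonoidAlgebra

variable {n : ℕ}

/-- The field of rational functions in variables `z_r`, `r : ℤ`, one for each row. -/
abbrev RowField : Type := FractionRing (AddMonoidAlgebra ℤ (ℤ →₀ ℤ))

/-- The universal character `s ↦ z ^ s` on row sums. -/
noncomputable def rowChar : Multiplicative (ℤ →₀ ℤ) →* RowField :=
  (algebraMap (AddMonoidAlgebra ℤ (ℤ →₀ ℤ)) RowField : _ →* RowField).comp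
    (AddMonoidAlgebra.of ℤ (ℤ →₀ ℤ))

theorem rowChar_apply (s : ℤ →₀ ℤ) :
    rowChar (.ofAdd s) = algebraMap (AddMonoidAlgebra ℤ (ℤ →₀ ℤ)) RowField (single s 1) :=
  rfl

theorem rowChar_injective : Function.Injective rowChar := by
  refine (IsFractionRing.injective (AddMonoidAlgebra ℤ (ℤ →₀ ℤ)) RowField).comp ?_
  exact AddMonoidAlgebra.of_injective

theorem aug_twist_rowWeight {ι : Type*} (row : ι → ℤ) (E : Finset ι)
    (p : AddMonoidAlgebra ℤ (ι → ℤ)) : aug (twist (rowWeight row E rowChar) p) =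
      algebraMap _ RowField (mapDomain (rowSum row E) p) := by
  induction p using AddMonoidAlgebra.induction_linear with
  | zero => simp
  | add p q hp hq => rw [map_add, map_add, hp, hq, mapDomain_add, map_add]
  | single a c =>
    rw [twist_single, aug_single, mapDomain_single, rowWeight_apply, rowChar_apply]
    have : (single (rowSum row E a) c : AddMonoidAlgebra ℤ (ℤ →₀ ℤ)) =
        (c : AddMonoidAlgebra ℤ (ℤ →₀ ℤ)) * single (rowSum row E a) 1 := by
      rw [← zsmul_eq_mul, smul_single, smul_eq_mul, mul_one]
    rw [this, map_mul, map_intCast]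

/-- The row of a node, as an integer. -/
abbrev Node.rowInt (u : Node n) : ℤ := u.row

/-- The map on exponent vectors induced by the substitution for the row variables `z_r`: the exponent
of `x_{k+1}` is the sum of row `k` minus the sum of row `k + 1`. -/
noncomputable def rowExponent (n : ℕ) : (ℤ →₀ ℤ) →+ (Fin n → ℤ) where
  toFun s k := s k - s (k + 1)
  map_zero' := by
    funext k
    simp
  map_add' s t := by
    funext k
    simp
    ring

/-- The substitution `t_{i,j} ↦ x_1` or `x_i⁻¹ x_{i+1}` factors through row sums. -/
theorem weightHom_eq (a : Node n → ℤ) :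
    weightHom n a = rowExponent n (rowSum Node.rowInt Finset.univ a) := by
  funext k
  have h : weightHom n a k = ∑ u : Node n, a u * nodeWeight u k := by
    simp [weightHom, Finset.sum_apply]
  rw [h]
  change _ = rowSum Node.rowInt Finset.univ a k - rowSum Node.rowInt Finset.univ a (k + 1)
  rw [rowSum_apply, rowSum_apply, ← Finset.sum_sub_distrib]
  refine Finset.sum_congr rfl fun u _ => ?_
  unfold nodeWeight Node.rowInt
  split_ifs <;> omega

theorem specPoly_eq_zero {p : LaurentPoly (Node n)}
    (h : mapDomain (rowSum Node.rowInt Finset.univ) p = 0) : specPoly n p = 0 := by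
  have e : weightHom n = (rowExponent n).comp (rowSum Node.rowInt Finset.univ) :=
    AddMonoidHom.ext weightHom_eq
  rw [specPoly, e, mapDomainRingHom_comp, RingHom.comp_apply]
  refine (congrArg _ ?_).trans (map_zero _)
  exact h

/-- The substitution is nontrivial on indicator vectors: the last row that meets the set
contributes a positive exponent. -/
theorem weightHom_ind_ne_zero {J : Set (Node n)} (hJ : J.Nonempty) : weightHom n (ind J) ≠ 0 := by
  obtain ⟨u, hu, hmax⟩ := Set.exists_max_image J Node.row J.toFinite hJ
  have hrow : u.row < n := by
    have := u.2
    simp only [Finset.mem_filter, Finset.mem_product, Finset.mem_range] at this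
    exact this.1.1
  intro h
  have h' := congrFun h ⟨u.row, hrow⟩
  rw [weightHom_eq] at h'
  change rowSum Node.rowInt Finset.univ (ind J) (u.row : ℤ) -
    rowSum Node.rowInt Finset.univ (ind J) ((u.row : ℤ) + 1) = 0 at h'
  rw [rowSum_apply, rowSum_apply, ← Finset.sum_sub_distrib] at h'
  refine absurd h' (ne_of_gt (Finset.sum_pos' (fun w _ => ?_) ⟨u, Finset.mem_univ _, ?_⟩))
  · unfold Node.rowInt
    by_cases hw : w ∈ J
    · have := hmax w hw
      have hne : ¬((w.row : ℤ) = u.row + 1) := by omega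
      rw [if_neg hne, sub_zero]
      split_ifs <;> simp [ind, hw]
    · simp [ind, hw]
  · simp [ind, hu]

theorem specPoly_ne_zero {D : Finset (Node n)} {o : Node n} {q : LaurentPoly (Node n)}
    (hq : q ∈ denominators 1 D o) : specPoly n q ≠ 0 := by
  induction hq using Submonoid.closure_induction with
  | mem q hq =>
    obtain ⟨v, ⟨J, -, hne, -, hv⟩, rfl⟩ := hq
    have hw : weightHom n v ≠ 0 := by
      rcases hv with rfl | rfl
      · exact weightHom_ind_ne_zero hne
      · rw [map_neg]
        exact neg_ne_zero.2 (weightHom_ind_ne_zero hne)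
    rw [map_sub, map_one, sub_ne_zero]
    intro h
    have h1 : specPoly n (single v ((1 : Multiplicative (Node n → ℤ) →* ℤ) (.ofAdd v))) =
        single (weightHom n v) 1 := mapDomain_single
    rw [h1, one_def] at h
    have h2 := congrArg (fun p : LaurentPoly (Fin n) => p.coeff 0) h
    simp [hw] at h2
  | one =>
    rw [map_one]
    exact one_ne_zero
  | mul p q _ _ hp hq =>
    rw [map_mul]
    exact mul_ne_zero hp hq

/-- The position of a node in the plane. -/
def nodePos (n : ℕ) : Node n ↪ ℤ × ℤ where
  toFun u := (u.row, u.col)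
  inj' u w h := by
    rw [Prod.mk.injEq, Nat.cast_inj, Nat.cast_inj] at h
    exact Subtype.ext (Prod.ext h.1 h.2)

theorem nodePos_apply (u : Node n) : nodePos n u = ((u.row : ℤ), (u.col : ℤ)) :=
  rfl

open Classical in
/-- The pairs of nodes of `D` between which the cone has an inequality. -/
noncomputable def nodeRel (D : Finset (Node n)) : Finset (Node n × Node n) :=
  (D ×ˢ D).filter fun e => UpperLeft e.1 e.2 ∨ UpperRight e.2 e.1

open Classical in
theorem nodeRel_subset (D : Finset (Node n)) : nodeRel D ⊆ D ×ˢ D :=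
  Finset.filter_subset _ _

open Classical in
theorem mem_nodeRel {D : Finset (Node n)} {e : Node n × Node n} : e ∈ nodeRel D ↔
    (e.1 ∈ D ∧ e.2 ∈ D) ∧ (UpperLeft e.1 e.2 ∨ UpperRight e.2 e.1) := by
  rw [nodeRel, Finset.mem_filter, Finset.mem_product]

theorem mem_gtRel_nodePos {D : Finset (Node n)} {u w : Node n} :
    (nodePos n u, nodePos n w) ∈ gtRel (D.map (nodePos n)) ↔ (u, w) ∈ nodeRel D := by
  rw [mem_gtRel, mem_nodeRel, Finset.mem_map', Finset.mem_map']
  refine and_congr_right fun _ => ?_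
  simp only [nodePos_apply, Prod.mk.injEq, UpperLeft, UpperRight]
  omega

theorem extendZero_mem_gtCone {D : Finset (Node n)} {o : Node n} (x : Node n → ℤ) :
    extendZero (nodePos n) x ∈ gtCone (D.map (nodePos n)) (nodePos n o) ↔
      x ∈ orderCone D o (nodeRel D) := by
  rw [gtCone, mem_orderCone, mem_orderCone, extendZero_apply]
  refine and_congr ⟨fun h u hu => ?_, fun h v hv => ?_⟩ (and_congr_right fun _ =>
    ⟨fun h e he => ?_, fun h e he => ?_⟩)
  · rw [← extendZero_apply (nodePos n) x]
    exact h _ (by rwa [Finset.mem_map'])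
  · by_cases hex : ∃ u, nodePos n u = v
    · obtain ⟨u, rfl⟩ := hex
      rw [extendZero_apply]
      exact h u (by rwa [Finset.mem_map'] at hv)
    · exact extendZero_apply_of_notMem _ _ fun u hu => hex ⟨u, hu⟩
  · have := h _ (mem_gtRel_nodePos.2 he)
    rwa [extendZero_apply, extendZero_apply] at this
  · obtain ⟨⟨h1, h2⟩, -⟩ := mem_gtRel.1 he
    obtain ⟨u, -, hu⟩ := Finset.mem_map.1 h1
    obtain ⟨w, -, hw⟩ := Finset.mem_map.1 h2
    have he' : e = (nodePos n u, nodePos n w) := Prod.ext hu.symm hw.symm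
    rw [he'] at he ⊢
    rw [extendZero_apply, extendZero_apply]
    exact h _ (mem_gtRel_nodePos.1 he)

theorem rowSum_extendZero (x : Node n → ℤ) :
    rowSum Prod.fst (Finset.univ.map (nodePos n)) (extendZero (nodePos n) x) =
      rowSum Node.rowInt Finset.univ x := by
  ext r
  rw [rowSum_apply, rowSum_apply, Finset.sum_map]
  refine Finset.sum_congr rfl fun u _ => ?_
  rw [extendZero_apply]
  rfl

theorem regZero_nodeCone {D : Finset (Node n)} {o : Node n} (ho : o ∈ D) {r₁ : ℤ} {a b : ℤ → ℤ}
    (h : IsShape (D.map (nodePos n)) o.row r₁ a b) :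
    RegZero (wInd (rowWeight Node.rowInt Finset.univ rowChar) (orderCone D o (nodeRel D))) := by
  refine RegZero.of_injective (extendZero_injective (nodePos n)) (fun x => ?_)
    extendZero_mem_gtCone (fun y hy => ?_)
    (reg_orderCone rowChar_injective (Finset.subset_univ _) ho (nodeRel_subset D))
    (h.regZero (E := Finset.univ.map (nodePos n)) (Finset.map_subset_map.2 (Finset.subset_univ _))
      ((Finset.mem_map' _).2 ho) rfl rowChar_injective)
  · rw [rowWeight_apply, rowWeight_apply, rowSum_extendZero]
  · refine ⟨fun u => y (nodePos n u), funext fun v => ?_⟩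
    by_cases hex : ∃ u, nodePos n u = v
    · obtain ⟨u, rfl⟩ := hex
      rw [extendZero_apply]
    · rw [extendZero_apply_of_notMem _ _ fun u hu => hex ⟨u, hu⟩]
      refine (hy.1 v fun hv => hex ?_).symm
      obtain ⟨u, -, hu⟩ := Finset.mem_map.1 hv
      exact ⟨u, hu⟩

/-! ### Ordinary subgraphs -/

theorem near_of_adj {u w : Node n} (h : (triangleGraph n).Adj u w) :
    Near (nodePos n u) (nodePos n w) := by
  rw [triangleGraph, SimpleGraph.fromRel_adj] at h
  simp only [UpperLeft, UpperRight] at h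
  simp only [Near, nodePos_apply]
  omega

variable {Δ : (triangleGraph n).Subgraph}

theorem row_eq_or_of_adj {u w : Δ.verts} (h : Δ.coe.Adj u w) :
    w.1.row = u.1.row + 1 ∨ u.1.row = w.1.row + 1 := by
  have := near_of_adj (Δ.adj_sub h)
  simp only [Near, nodePos_apply] at this
  omega

/-- The neighbors in a cycle of a vertex in the lowest row that the cycle meets are distinct nodes
of the same row. -/
theorem exists_row_of_isCycle {u : Δ.verts} {c : Δ.coe.Walk u u} (hc : c.IsCycle) :
    ∃ v w : Δ.verts, v.1.row = w.1.row ∧ v ≠ w := by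
  classical
  obtain ⟨m, hm, hmax⟩ := Set.exists_max_image {v | v ∈ c.support} (fun v => v.1.row)
    (Set.toFinite _) ⟨u, c.start_mem_support⟩
  have hc' := hc.rotate hm
  have hnil := hc'.not_nil
  have hmem : ∀ v ∈ (c.rotate m hm).support, v.1.row ≤ m.1.row := fun v hv =>
    hmax v ((c.mem_support_rotate_iff m hm).1 hv)
  refine ⟨(c.rotate m hm).snd, (c.rotate m hm).penultimate, ?_, hc'.snd_ne_penultimate⟩
  have h1 := row_eq_or_of_adj ((c.rotate m hm).adj_snd hnil)
  have h2 := row_eq_or_of_adj ((c.rotate m hm).adj_penultimate hnil)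
  have h3 := hmem _ ((c.rotate m hm).getVert_mem_support 1)
  have h4 := hmem _ ((c.rotate m hm).getVert_mem_support ((c.rotate m hm).length - 1))
  change (c.rotate m hm).snd.1.row ≤ _ at h3
  change (c.rotate m hm).penultimate.1.row ≤ _ at h4
  omega

theorem exists_isPath (hΔ : IsOrdinary Δ) {D : Finset (Node n)} (hD : ∀ u, u ∈ D ↔ u ∈ Δ.verts) :
    ∀ u ∈ D.map (nodePos n), ∀ w ∈ D.map (nodePos n),
      ∃ p l, IsPath (D.map (nodePos n)) p l ∧ p 0 = u ∧ p l = w := by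
  intro u hu w hw
  obtain ⟨u, huD, rfl⟩ := Finset.mem_map.1 hu
  obtain ⟨w, hwD, rfl⟩ := Finset.mem_map.1 hw
  obtain ⟨q⟩ := hΔ.connected.coe.preconnected ⟨u, (hD u).1 huD⟩ ⟨w, (hD w).1 hwD⟩
  refine ⟨fun t => nodePos n (q.getVert t).1, q.length, ⟨fun t _ => ?_, fun t ht => ?_⟩, ?_, ?_⟩
  · exact (Finset.mem_map' _).2 ((hD _).2 (q.getVert t).2)
  · exact near_of_adj (Δ.adj_sub (q.adj_getVert_succ ht))
  · simp
  · simp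

theorem hasDiamonds (hΔ : IsOrdinary Δ) {D : Finset (Node n)} (hD : ∀ u, u ∈ D ↔ u ∈ Δ.verts) :
    HasDiamonds (D.map (nodePos n)) := by
  intro r c h h'
  obtain ⟨u, hu, hur⟩ := Finset.mem_map.1 h
  obtain ⟨w, hw, hwr⟩ := Finset.mem_map.1 h'
  rw [nodePos_apply, Prod.mk.injEq] at hur hwr
  obtain ⟨⟨x, hx, hx1, hx2⟩, ⟨y, hy, hy1, hy2⟩⟩ :=
    hΔ.propertyA u ((hD u).1 hu) w ((hD w).1 hw) (by omega) (by omega)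
  refine ⟨Finset.mem_map.2 ⟨x, (hD x).2 hx, ?_⟩, Finset.mem_map.2 ⟨y, (hD y).2 hy, ?_⟩⟩ <;>
  · rw [nodePos_apply, Prod.mk.injEq]
    omega

/-- The integer points of the cone of an ordinary subgraph are those of an order cone. Since the
subgraph is induced, its edges need not be mentioned. -/
theorem mem_cone_iff (hΔ : IsOrdinary Δ) {D : Finset (Node n)} (hD : ∀ u, u ∈ D ↔ u ∈ Δ.verts)
    {o : Node n} (ho : ∀ u, IsTopNode Δ u ↔ u = o) (x : Node n → ℤ) :
    (fun u => (x u : ℝ)) ∈ cone Δ ↔ x ∈ orderCone D o (nodeRel D) := by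
  rw [mem_orderCone]
  change ((∀ u, u ∉ Δ.verts → (x u : ℝ) = 0) ∧ (∀ u, IsTopNode Δ u → (x u : ℝ) = 0) ∧
    ∀ u w, Δ.Adj u w → (UpperLeft u w → (x w : ℝ) ≤ x u) ∧ (UpperRight u w → (x u : ℝ) ≤ x w)) ↔ _
  have hadj : ∀ {u w}, u ∈ Δ.verts → w ∈ Δ.verts → (UpperLeft u w ∨ UpperRight u w) →
      Δ.Adj u w := by
    intro u w hu hw h
    refine hΔ.induced hu hw ?_
    rw [triangleGraph, SimpleGraph.fromRel_adj]
    refine ⟨?_, .inl h⟩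
    rintro rfl
    simp only [UpperLeft, UpperRight] at h
    omega
  constructor
  · rintro ⟨h1, h2, h3⟩
    refine ⟨fun u hu => ?_, ?_, fun e he => ?_⟩
    · exact_mod_cast h1 u fun h => hu ((hD u).2 h)
    · exact_mod_cast h2 o ((ho o).2 rfl)
    · obtain ⟨⟨hu, hw⟩, h⟩ := mem_nodeRel.1 he
      rw [hD] at hu hw
      rcases h with h | h
      · exact_mod_cast (h3 _ _ (hadj hu hw (.inl h))).1 h
      · exact_mod_cast (h3 _ _ (hadj hw hu (.inr h))).2 h
  · rintro ⟨h1, h2, h3⟩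
    refine ⟨fun u hu => ?_, fun u hu => ?_, fun u w huw => ⟨fun h => ?_, fun h => ?_⟩⟩
    · exact_mod_cast h1 u fun h => hu ((hD u).1 h)
    · rw [(ho u).1 hu]
      exact_mod_cast h2
    · exact_mod_cast h3 (u, w) (mem_nodeRel.2
        ⟨⟨(hD u).2 (Δ.edge_vert huw), (hD w).2 (Δ.edge_vert huw.symm)⟩, .inl h⟩)
    · exact_mod_cast h3 (w, u) (mem_nodeRel.2
        ⟨⟨(hD w).2 (Δ.edge_vert huw.symm), (hD u).2 (Δ.edge_vert huw)⟩, .inr h⟩)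

end Triangle

end GTCone

theorem mainTheorem3 (n : ℕ) (Δ : (GTCone.triangleGraph n).Subgraph)
    (hΔ : GTCone.IsOrdinary Δ)
    (hcycle : ∃ (u : Δ.verts) (c : Δ.coe.Walk u u), c.IsCycle) :
    GTCone.HasTransform (GTCone.cone Δ) ∧
      GTCone.Specializable (GTCone.sigma (GTCone.cone Δ)) ∧
      GTCone.F (GTCone.sigma (GTCone.cone Δ)) = 0 := by
  classical
  open GTCone in
  obtain ⟨u, c, hc⟩ := hcycle
  obtain ⟨v, w, hrow, hne⟩ := exists_row_of_isCycle hc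
  set D : Finset (Node n) := Finset.univ.filter fun u => u ∈ Δ.verts with hDdef
  have hD : ∀ u, u ∈ D ↔ u ∈ Δ.verts := fun u => by simp [hDdef]
  obtain ⟨r₀, r₁, a, b, hshape⟩ : ∃ r₀ r₁ a b, IsShape (D.map (nodePos n)) r₀ r₁ a b := by
    have hmem : ∀ x : Δ.verts, nodePos n x.1 ∈ D.map (nodePos n) := fun x =>
      (Finset.mem_map' _).2 ((hD _).2 x.2)
    have hv := hmem v
    have hw := hmem w
    have hcol : v.1.col ≠ w.1.col := fun h => hne (Subtype.ext (Subtype.ext (Prod.ext hrow h)))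
    rw [nodePos_apply] at hv hw
    rw [hrow] at hv
    rcases lt_or_gt_of_ne hcol with h | h
    · exact exists_isShape (hasDiamonds hΔ hD) (exists_isPath hΔ hD) (Nat.cast_lt.2 h) hv hw
    · exact exists_isShape (hasDiamonds hΔ hD) (exists_isPath hΔ hD) (Nat.cast_lt.2 h) hw hv
  obtain ⟨rw', hrw0, hrw1, -⟩ := hshape.wide
  have h01 : r₀ ≤ r₁ := hrw0.trans hrw1
  obtain ⟨o, hoD, ho⟩ := Finset.mem_map.1
    ((hshape.mem r₀ (a r₀)).2 ⟨⟨le_rfl, h01⟩, le_rfl, hshape.first.le⟩)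
  rw [nodePos_apply, Prod.mk.injEq] at ho
  have hpos : ∀ u, u ∈ Δ.verts → (r₀ ≤ (u.row : ℤ) ∧ (u.row : ℤ) ≤ r₁) ∧
      a u.row ≤ u.col ∧ (u.col : ℤ) ≤ b u.row := fun u hu =>
    (hshape.mem _ _).1 ((Finset.mem_map' (nodePos n)).2 ((hD u).2 hu))
  have htop : ∀ u, IsTopNode Δ u ↔ u = o := by
    intro u
    constructor
    · rintro ⟨hu, hmin⟩
      have h1 := hmin o ((hD o).1 hoD)
      have h2 := hpos u hu
      have h3 : (u.row : ℤ) = r₀ := by omega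
      rw [h3] at h2
      have h4 := hshape.first
      have h5 : u.row = o.row := by omega
      have h6 : u.col = o.col := by omega
      exact Subtype.ext (Prod.ext h5 h6)
    · rintro rfl
      refine ⟨(hD u).1 hoD, fun w hw => ?_⟩
      have := hpos w hw
      omega
  have hgen : genFun (cone Δ) = wInd 1 (orderCone D o (nodeRel D)) := by
    funext x
    have hiff := mem_cone_iff hΔ hD htop x
    by_cases hx : x ∈ orderCone D o (nodeRel D)
    · rw [wInd_of_mem _ hx]
      exact if_pos (hiff.2 hx)
    · rw [wInd_of_notMem _ hx]
      exact if_neg fun h => hx (hiff.1 h)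
  -- One multiplier `q`, a product of denominators of rays, serves both for the transform and for
  -- its specialization; the numerator `p` vanishes under the specialization.
  obtain ⟨q, hq, p, e⟩ := isRational_orderCone (k := ℤ) (χ := 1) hoD (nodeRel D) (nodeRel_subset D)
  have hspec := specPoly_ne_zero hq
  have hpair : IsTransformPair (cone Δ) p q := by
    refine ⟨?_, ?_⟩
    · rintro rfl
      exact hspec (map_zero _)
    · rw [hgen]
      exact e
  have hspecPair : IsSpecPair (sigma (cone Δ)) p q := ⟨hspec, sigma_eq hpair⟩
  refine ⟨⟨p, q, hpair⟩, ⟨p, q, hspecPair⟩, ?_⟩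
  have hzero := (regZero_nodeCone hoD (ho.1 ▸ hshape)).aug_twist_eq_zero e
  rw [aug_twist_rowWeight] at hzero
  have hp : specPoly n p = 0 := specPoly_eq_zero
    ((map_eq_zero_iff _ (IsFractionRing.injective _ _)).1 hzero)
  rw [F_eq hspecPair, hp, map_zero, zero_div]
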